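/- Let $b\ge 2$ and let $\mathbb{T}_b$ be the $b$-ary tree: its root $\rho$ has degree $1$ and every vertex $v\neq\rho$ has a parent $v^{(0)}$ and exactly $b$ children $v^{(1)},\dots,v^{(b)}$. A rotor configuration is a map $r$ from the set of non-root vertices to $\{0,1,\dots,b\}$; it means that the rotor at $v$ points to $v^{(r(v))}$. At each step of the rotor walk, if the particle is at $v\ne\rho$, the rotor at $v$ is first advanced to the next neighbour in the cyclic order $v^{(0)},v^{(1)},\dots,v^{(b)}$ and then the particle moves to that neighbour; from $\rho$ the particle moves to its only child. A particle started at $\rho$ is run until its first return to $\rho$; if it never returns, it escapes to infinity, visiting each vertex only finitely often, so that in either case a final rotor configuration is well defined. Particles are run from $\rho$ one after the other, each starting with the rotor configuration left by the previous one, and $E_n(\mathbb{T}_b,r)$ is the number of the first $n$ particles that escape, when the initial configuration is $r$. Let $\mathcal{E}$ be the probability that simple symmetric random walk on $\mathbb{T}_b$ started at $\rho$ never returns to $\rho$. Let $R=(R(v))_{v\neq\rho}$ be a random rotor configuration on $\mathbb{T}_b$ whose entries are independent and identically distributed random variables in $\{0,1,\dots,b\}$ whose common law is not concentrated at a single point,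 and let $v\ne\rho$ be any vertex. Then $\mathcal{E}=\frac{b-1}{b}$, and (i) if $\mathbb{E}R(v)<b-1$, then almost surely $\displaystyle\lim_{n\to\infty}\frac{E_n(\mathbb{T}_b,R)}{n}=\mathcal{E}$; (ii) if $\mathbb{E}R(v)\ge b-1$, then almost surely $E_n(\mathbb{T}_b,R)=0$ for all $n\ge 0$. -/

import Mathlib

open MeasureTheory ProbabilityTheory Filter Topology

namespace RotorTree

/-- Non-root vertices of the `b`-ary tree, written as finite words: `[]` is the only child of the
root, and `i :: v` is the child number `i + 1` of `v` (for `i = 0, …, b - 1`). -/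
abbrev NonRoot (b : ℕ) := List (Fin b)

/-- Vertices of the `b`-ary tree: `none` is the root, which has degree one. -/
abbrev Vertex (b : ℕ) := Option (NonRoot b)

/-- The parent of a non-root vertex. -/
def parent {b : ℕ} : NonRoot b → Vertex b
  | [] => none
  | _ :: v => some v

/-- The neighbours `v⁽⁰⁾, v⁽¹⁾, …, v⁽ᵇ⁾` of a non-root vertex `v`, in the cyclic order of the rotor:
number `0` is the parent, numbers `1, …, b` are the children. -/
def nbr {b : ℕ} (v : NonRoot b) (k : Fin (b + 1)) : Vertex b :=
  Fin.cases (parent v) (fun i => some (i :: v)) k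

/-- A rotor configuration: the rotor at `v` points to `nbr v (r v)`. (The rotor at the root always
points to its only child.) -/
abbrev Config (b : ℕ) := NonRoot b → Fin (b + 1)

/-- One step of the rotor walk: increment the rotor at the current position (cyclically, that is
modulo `b + 1`), then move the particle to where the rotor now points. -/
def step {b : ℕ} : Vertex b × Config b → Vertex b × Config b
  | (none, r) => (some [], r)
  | (some v, r) => (nbr v (r v + 1), Function.update r v (r v + 1))

/-- The particle position and the rotors after `t` steps, for a particle started at the root with
rotor configuration `r`. -/
def walk {b : ℕ} (r : Config b) (t : ℕ) : Vertex b × Config b := step^[t] (none, r)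

/-- The particle started at the root comes back to the root after finitely many steps. -/
def Returns {b : ℕ} (r : Config b) : Prop := ∃ t : ℕ, 1 ≤ t ∧ (walk r t).1 = none

/-- The particle escapes to infinity. -/
def Escapes {b : ℕ} (r : Config b) : Prop := ¬ Returns r

theorem walk_succ {b : ℕ} (r : Config b) (t : ℕ) : walk r (t + 1) = step (walk r t) :=
  Function.iterate_succ_apply' _ _ _

theorem step_of_pos {b : ℕ} {s : Vertex b × Config b} {v : NonRoot b} (h : s.1 = some v) :
    step s = (nbr v (s.2 v + 1), Function.update s.2 v (s.2 v + 1)) := by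
  obtain ⟨p, c⟩ := s
  simp only at h
  subst h
  rfl

theorem step_of_ne {b : ℕ} {s : Vertex b × Config b} {v : NonRoot b} (h : s.1 ≠ some v) :
    (step s).2 v = s.2 v := by
  obtain ⟨p, c⟩ := s
  rcases p with _ | w
  · rfl
  · have : v ≠ w := fun e => h (by simp [e])
    simp [step, Function.update_of_ne this]

/-- If from some time on the particle is never at the parent of `v`, then it stops visiting
`v`. -/
theorem eventually_ne_of_parent {b : ℕ} (r : Config b) (v : NonRoot b)
    (hp : ∀ᶠ t in atTop, (walk r t).1 ≠ parent v) :
    ∀ᶠ t in atTop, (walk r t).1 ≠ some v := by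
  obtain ⟨T, hT⟩ := eventually_atTop.1 hp
  by_contra hinf
  have hfreq : ∀ N, ∃ t ≥ N, (walk r t).1 = some v := by
    intro N
    by_contra hN
    push Not at hN
    exact hinf (eventually_atTop.2 ⟨N, hN⟩)
  have key : ∀ k : ℕ, ∃ t ≥ T, k ≤ (((walk r t).2 v : Fin (b + 1)) : ℕ) := by
    intro k
    induction k with
    | zero => exact ⟨T, le_rfl, Nat.zero_le _⟩
    | succ k ih =>
      obtain ⟨t, ht, hk⟩ := ih
      have hex : ∃ m, (walk r (t + m)).1 = some v := by
        obtain ⟨s, hs, hs'⟩ := hfreq t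
        exact ⟨s - t, by rwa [Nat.add_sub_cancel' hs]⟩
      classical
      have hconst : ∀ m ≤ Nat.find hex, (walk r (t + m)).2 v = (walk r t).2 v := by
        intro m
        induction m with
        | zero => intro _; rfl
        | succ m ihm =>
          intro hm
          rw [← ihm (by omega), ← add_assoc, walk_succ]
          exact step_of_ne (Nat.find_min hex (by omega))
      have hs := Nat.find_spec hex
      have hc := hconst _ le_rfl
      set s := t + Nat.find hex with hsdef
      have hstep := step_of_pos hs
      rw [← walk_succ, hc] at hstep
      refine ⟨s + 1, by omega, ?_⟩
      rw [hstep]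
      simp only [Function.update_self]
      have hne : (walk r t).2 v + 1 ≠ 0 := by
        intro h0
        apply hT (s + 1) (by omega)
        rw [hstep, h0]
        rfl
      have hlast : (walk r t).2 v ≠ Fin.last b := by
        intro h
        exact hne (by rw [h]; exact Fin.last_add_one b)
      rw [Fin.val_add_one]
      simp only [hlast, if_false]
      omega
  obtain ⟨t, -, ht⟩ := key (b + 1)
  have := ((walk r t).2 v).isLt
  omega

/-- An escaping particle visits each vertex only finitely many times. -/
theorem Escapes.eventually_ne {b : ℕ} {r : Config b} (h : Escapes r) (v : NonRoot b) :
    ∀ᶠ t in atTop, (walk r t).1 ≠ some v := by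
  induction v with
  | nil =>
    exact eventually_ne_of_parent r [] (eventually_atTop.2 ⟨1, fun t ht h0 => h ⟨t, ht, h0⟩⟩)
  | cons i w ih => exact eventually_ne_of_parent r (i :: w) ih

/-- While a particle escapes, the rotor at each vertex eventually stops moving. -/
theorem Escapes.exists_eventually_eq {b : ℕ} {r : Config b} (h : Escapes r) (v : NonRoot b) :
    ∃ k : Fin (b + 1), ∀ᶠ t in atTop, (walk r t).2 v = k := by
  obtain ⟨T, hT⟩ := eventually_atTop.1 (h.eventually_ne v)
  refine ⟨(walk r T).2 v, eventually_atTop.2 ⟨T, fun t ht => ?_⟩⟩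
  induction t, ht using Nat.le_induction with
  | base => rfl
  | succ t ht ih => rw [walk_succ, step_of_ne (hT t ht), ih]

open Classical in
/-- The rotor configuration left behind by one particle started at the root: the one at the first
return to the root if the particle returns, and the limiting one if it escapes. -/
noncomputable def final {b : ℕ} (r : Config b) : Config b :=
  if h : Returns r then (walk r (Nat.find h)).2
  else fun v => (Escapes.exists_eventually_eq (r := r) h v).choose

open Classical in
/-- The number `E_n` of escaping particles among the first `n`, when particles are run one after the
other from the root, each starting with the rotors left behind by the previous one. -/
noncomputable def escapeCount {b : ℕ} (r : Config b) (n : ℕ) : ℕ :=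
  ((Finset.range n).filter fun i => Escapes (final^[i] r)).card

/-- The walk from the root in which the `t`-th step leads from a non-root vertex `v` to its
neighbour number `u t`, and from the root to its only neighbour. -/
def srw {b : ℕ} (u : ℕ → Fin (b + 1)) : ℕ → Vertex b
  | 0 => none
  | t + 1 => match srw u t with
    | none => some []
    | some v => nbr v (u t)

/-- The probability that simple symmetric random walk on the `b`-ary tree, started at the root,
never returns to the root. The walk is driven by independent uniform choices of neighbours. -/
noncomputable def escapeProb (b : ℕ) : ℝ :=
  (Measure.infinitePi fun _ : ℕ => (PMF.uniformOfFintype (Fin (b + 1))).toMeasure).real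
    {u | ∀ t : ℕ, 1 ≤ t → srw u t ≠ none}

end RotorTree

/-!
Cutting the tree at the child of the root turns a rotor configuration `r` into `b` independent
copies `branch r i` of itself and the rotor at the cut, through which the escapes are counted
recursively: a particle which has reached the cut escapes through the branch the rotor shows next,
or comes back. Bounding the recursion from above gives an escape rate of at most `(b - 1) / b` for
every `r`. From below, the lower rate obeys the series law
`1 / rate r ≤ 1 + 1 / ∑ i, rate (branch r i)`. If `I`, the mean of `1 / rate`, is finite, then
`I ≤ 1 + I / b` by the inequality between harmonic and arithmetic means, so that `I ≤ b / (b - 1)`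
and the rate equals `(b - 1) / b` almost surely.

Call a child live when the rotor of its parent reaches it before the parent's own parent. The live
vertices connected to the root form a Galton–Watson tree. If the mean number of live children is
larger than `1`, then this tree carries a flow of bounded energy, which makes the rate positive with
positive probability, and the independence of the branches turns this into `I < ∞`. If the mean is
at most `1`, then extinction of the tree shows by induction on the number of particles that none
escapes.
-/

namespace RotorTree

open scoped ENNReal NNReal

variable {b : ℕ}

/-! ### Branches of a rotor configuration -/

/-- The configuration on the branch number `i` of the tree, that is on the part above the child
`[i]` of `[]`. Its own root is the vertex `[]` of the whole tree. -/
def branch (r : Config b) (i : Fin b) : Config b := fun w => r (w ++ [i])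

/-- The configuration obtained from `r` by replacing the branch number `i` by `s`. -/
def graft (r : Config b) (i : Fin b) (s : Config b) : Config b :=
  fun u => if u.getLast? = some i then s u.dropLast else r u

/-- The inclusion of the branch number `i` into the whole tree, which sends the root of the branch
to `[]`. -/
def embed (i : Fin b) : Vertex b → Vertex b
  | none => some []
  | some w => some (w ++ [i])

@[simp] theorem graft_nil (r : Config b) (i : Fin b) (s : Config b) :
    graft r i s [] = r [] := by simp [graft]

@[simp] theorem graft_append_self (r : Config b) (i : Fin b) (s : Config b) (w : NonRoot b) :
    graft r i s (w ++ [i]) = s w := by simp [graft]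

theorem graft_append_of_ne (r : Config b) {i j : Fin b} (h : j ≠ i) (s : Config b)
    (w : NonRoot b) : graft r i s (w ++ [j]) = r (w ++ [j]) := by simp [graft, h]

theorem config_ext {r s : Config b} (hnil : r [] = s []) (hbranch : ∀ i, branch r i = branch s i) :
    r = s := by
  funext u
  rcases List.eq_nil_or_concat u with rfl | ⟨w, i, rfl⟩
  · exact hnil
  · rw [List.concat_eq_append]
    exact congrFun (hbranch i) w

@[simp] theorem branch_graft_self (r : Config b) (i : Fin b) (s : Config b) :
    branch (graft r i s) i = s := by
  funext w; simp [branch]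

theorem branch_graft_of_ne (r : Config b) {i j : Fin b} (h : j ≠ i) (s : Config b) :
    branch (graft r i s) j = branch r j := by
  funext w; simp [branch, graft_append_of_ne r h]

@[simp] theorem branch_update_nil (r : Config b) (k : Fin (b + 1)) (i : Fin b) :
    branch (Function.update r [] k) i = branch r i := by
  funext w
  exact Function.update_of_ne (by simp) _ _

theorem branch_update_append_self (r : Config b) (w : NonRoot b) (i : Fin b) (k : Fin (b + 1)) :
    branch (Function.update r (w ++ [i]) k) i = Function.update (branch r i) w k := by
  funext w'
  simp [branch, Function.update_apply]

theorem branch_update_append_of_ne (r : Config b) (w : NonRoot b) {i j : Fin b} (h : j ≠ i)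
    (k : Fin (b + 1)) : branch (Function.update r (w ++ [i]) k) j = branch r j := by
  funext w'
  simp [branch, h]

theorem graft_branch (r : Config b) (i : Fin b) : graft r i (branch r i) = r := by
  refine config_ext (graft_nil _ _ _) fun j => ?_
  by_cases h : j = i
  · rw [h, branch_graft_self]
  · rw [branch_graft_of_ne r h]

theorem update_graft (r : Config b) (i : Fin b) (s : Config b) (w : NonRoot b)
    (k : Fin (b + 1)) :
    Function.update (graft r i s) (w ++ [i]) k = graft r i (Function.update s w k) := by
  refine config_ext (by simp) fun j => ?_
  by_cases h : j = i
  · rw [h, branch_update_append_self, branch_graft_self, branch_graft_self]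
  · rw [branch_update_append_of_ne _ _ h, branch_graft_of_ne _ h, branch_graft_of_ne _ h]

theorem embed_ne_none (i : Fin b) (x : Vertex b) : embed i x ≠ none := by
  cases x <;> simp [embed]

theorem nbr_append (w : NonRoot b) (i : Fin b) (k : Fin (b + 1)) :
    nbr (w ++ [i]) k = embed i (nbr w k) := by
  cases k using Fin.cases with
  | zero => cases w <;> rfl
  | succ j => rfl

theorem step_embed_graft (i : Fin b) (r : Config b) (s : Vertex b × Config b) (h : s.1 ≠ none) :
    step (embed i s.1, graft r i s.2) = (embed i (step s).1, graft r i (step s).2) := by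
  obtain ⟨_ | w, c⟩ := s
  · exact absurd rfl h
  · simp [embed, step, nbr_append, update_graft]

/-! ### The walk of one particle -/

theorem walk_one (r : Config b) : walk r 1 = (some [], r) := rfl

theorem walk_two (r : Config b) :
    walk r 2 = (nbr [] (r [] + 1), Function.update r [] (r [] + 1)) := rfl

theorem walk_add_of_eq {r r' : Config b} {T : ℕ} (h : walk r (T + 1) = walk r' 1) (t : ℕ) :
    walk r (T + (t + 1)) = walk r' (t + 1) := by
  induction t with
  | zero => exact h
  | succ t ih => rw [← add_assoc, walk_succ, ih, ← walk_succ]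

theorem walk_add_two_eq_embed {r : Config b} {i : Fin b} (hi : r [] = i.castSucc) (t : ℕ)
    (ht : ∀ u, 1 ≤ u → u < t + 1 → (walk (branch r i) u).1 ≠ none) :
    walk r (t + 2) = (embed i (walk (branch r i) (t + 1)).1,
      graft (Function.update r [] i.succ) i (walk (branch r i) (t + 1)).2) := by
  induction t with
  | zero =>
    have hgraft := graft_branch (Function.update r [] i.succ) i
    rw [branch_update_nil] at hgraft
    rw [zero_add, zero_add, walk_two, walk_one, hi, Fin.coeSucc_eq_succ, hgraft]
    rfl
  | succ t ih =>
    rw [walk_succ, ih fun u h1 h2 => ht u h1 (by omega),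
      step_embed_graft _ _ _ (ht _ (by omega) (by omega)), ← walk_succ]

theorem eventually_add_iff (k : ℕ) {p : ℕ → Prop} :
    (∀ᶠ t in atTop, p (t + k)) ↔ ∀ᶠ t in atTop, p t := by
  conv_rhs => rw [← map_add_atTop_eq_nat k, eventually_map]

theorem final_apply_of_eventually {r : Config b} (h : Escapes r) {v : NonRoot b}
    {k : Fin (b + 1)} (hk : ∀ᶠ t in atTop, (walk r t).2 v = k) : final r v = k := by
  obtain ⟨t, ht, htk⟩ := ((h.exists_eventually_eq v).choose_spec.and hk).exists
  rw [final, dif_neg h]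
  exact ht.symm.trans htk

theorem Escapes.eventually_eq_final {r : Config b} (h : Escapes r) (v : NonRoot b) :
    ∀ᶠ t in atTop, (walk r t).2 v = final r v := by
  obtain ⟨k, hk⟩ := h.exists_eventually_eq v
  rwa [final_apply_of_eventually h hk]

/-- The particle started at the root with rotors `r` first returns to the root at time `t`. -/
structure FirstReturn (r : Config b) (t : ℕ) : Prop where
  one_le : 1 ≤ t
  walk_eq : (walk r t).1 = none
  walk_ne : ∀ u, 1 ≤ u → u < t → (walk r u).1 ≠ none

theorem FirstReturn.returns {r : Config b} {t : ℕ} (h : FirstReturn r t) : Returns r :=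
  ⟨t, h.one_le, h.walk_eq⟩

theorem exists_firstReturn {r : Config b} (h : ¬ Escapes r) : ∃ t, FirstReturn r t := by
  classical
  have h' : Returns r := not_not.1 h
  exact ⟨Nat.find h', (Nat.find_spec h').1, (Nat.find_spec h').2,
    fun u h1 h2 h3 => Nat.find_min h' h2 ⟨h1, h3⟩⟩

open Classical in
theorem FirstReturn.find_eq {r : Config b} {t : ℕ} (h : FirstReturn r t) :
    Nat.find h.returns = t :=
  (Nat.find_eq_iff _).2 ⟨⟨h.one_le, h.walk_eq⟩, fun u hu h' => h.walk_ne u h'.1 hu h'.2⟩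

theorem FirstReturn.final_eq {r : Config b} {t : ℕ} (h : FirstReturn r t) :
    final r = (walk r t).2 := by
  classical
  rw [final, dif_pos h.returns, h.find_eq]

open Classical in
/-- The time of the first return to the root, infinite if the particle escapes. -/
noncomputable def returnTime (r : Config b) : ℕ∞ :=
  if h : Returns r then (Nat.find h : ℕ∞) else ⊤

theorem FirstReturn.returnTime_eq {r : Config b} {t : ℕ} (h : FirstReturn r t) :
    returnTime r = t := by
  classical
  rw [returnTime, dif_pos h.returns, h.find_eq]

theorem Escapes.returnTime_eq {r : Config b} (h : Escapes r) : returnTime r = ⊤ := by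
  rw [returnTime, dif_neg h]

theorem returnTime_ne_top {r : Config b} (h : ¬ Escapes r) : returnTime r ≠ ⊤ := by
  obtain ⟨t, ht⟩ := exists_firstReturn h
  rw [ht.returnTime_eq]
  exact ENat.natCast_ne_top t

theorem firstReturn_of_last {r : Config b} (h : r [] = Fin.last b) : FirstReturn r 2 := by
  refine ⟨by omega, ?_, fun u h1 h2 => ?_⟩
  · rw [walk_two, h, Fin.last_add_one]; rfl
  · obtain rfl : u = 1 := by omega
    simp [walk_one]

theorem not_escapes_of_last {r : Config b} (h : r [] = Fin.last b) : ¬ Escapes r :=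
  fun h' => h' (firstReturn_of_last h).returns

theorem final_of_last {r : Config b} (h : r [] = Fin.last b) :
    final r = Function.update r [] 0 := by
  rw [(firstReturn_of_last h).final_eq, walk_two, h, Fin.last_add_one]

/-- The configuration after the rotor at `[]` has sent the particle into the branch number `i` and
the particle has left this branch, either back to `[]` or to infinity. -/
noncomputable def advance (r : Config b) (i : Fin b) : Config b :=
  graft (Function.update r [] i.succ) i (final (branch r i))

@[simp] theorem advance_nil (r : Config b) (i : Fin b) : advance r i [] = i.succ := by
  simp [advance]

theorem branch_advance_self (r : Config b) (i : Fin b) :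
    branch (advance r i) i = final (branch r i) := by simp [advance]

theorem branch_advance_of_ne (r : Config b) {i j : Fin b} (h : j ≠ i) :
    branch (advance r i) j = branch r j := by simp [advance, branch_graft_of_ne _ h]

theorem advance_induction {motive : Config b → Prop}
    (last : ∀ r, r [] = Fin.last b → motive r)
    (castSucc : ∀ r i, r [] = i.castSucc → motive (advance r i) → motive r) (r : Config b) :
    motive r := by
  induction hk : r [] using Fin.reverseInduction generalizing r with
  | last => exact last r hk
  | cast i ih => exact castSucc r i hk (ih _ (advance_nil r i))

theorem escapes_of_branch {r : Config b} {i : Fin b} (hi : r [] = i.castSucc)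
    (h : Escapes (branch r i)) : Escapes r := by
  rintro ⟨_ | _ | t, h1, h2⟩
  · omega
  · simp [walk_one] at h2
  · rw [walk_add_two_eq_embed hi t fun u hu _ h0 => h ⟨u, hu, h0⟩] at h2
    exact embed_ne_none _ _ h2

theorem final_of_escapes_branch {r : Config b} {i : Fin b} (hi : r [] = i.castSucc)
    (h : Escapes (branch r i)) : final r = advance r i := by
  have hfinal {v : NonRoot b} {k : Fin (b + 1)}
      (hk : ∀ᶠ t in atTop, graft (Function.update r [] i.succ) i
        (walk (branch r i) (t + 1)).2 v = k) : final r v = k := by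
    refine final_apply_of_eventually (escapes_of_branch hi h) ((eventually_add_iff 2).1 ?_)
    filter_upwards [hk] with t ht
    rwa [walk_add_two_eq_embed hi t fun u hu _ h0 => h ⟨u, hu, h0⟩]
  refine config_ext (hfinal (by simp)) fun j => funext fun w =>
    hfinal (v := w ++ [j]) (k := advance r i (w ++ [j])) ?_
  by_cases hj : j = i
  · subst hj
    simp only [advance, graft_append_self]
    exact (eventually_add_iff 1).2 (h.eventually_eq_final w)
  · simp [advance, graft_append_of_ne _ hj]

theorem walk_add_of_firstReturn_branch {r : Config b} {i : Fin b} (hi : r [] = i.castSucc)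
    {T : ℕ} (h : FirstReturn (branch r i) T) (t : ℕ) :
    walk r (T + (t + 1)) = walk (advance r i) (t + 1) := by
  apply walk_add_of_eq
  obtain ⟨T, rfl⟩ := Nat.exists_eq_add_of_le' h.one_le
  rw [walk_add_two_eq_embed hi T h.walk_ne, walk_one, advance, h.final_eq, h.walk_eq]
  rfl

theorem walk_ne_none_of_firstReturn_branch {r : Config b} {i : Fin b}
    (hi : r [] = i.castSucc) {T : ℕ} (h : FirstReturn (branch r i) T) {t : ℕ} (h1 : 1 ≤ t)
    (h2 : t ≤ T) : (walk r t).1 ≠ none := by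
  rcases t with _ | _ | t
  · omega
  · simp [walk_one]
  · rw [walk_add_two_eq_embed hi t fun u hu hu' => h.walk_ne u hu (by omega)]
    exact embed_ne_none _ _

theorem FirstReturn.add {r : Config b} {i : Fin b} {T t : ℕ} (h : FirstReturn (branch r i) T)
    (hi : r [] = i.castSucc) (ht : FirstReturn (advance r i) t) : FirstReturn r (T + t) := by
  obtain ⟨t, rfl⟩ := Nat.exists_eq_add_of_le' ht.one_le
  refine ⟨by omega, ?_, fun u h1 h2 => ?_⟩
  · rw [walk_add_of_firstReturn_branch hi h]
    exact ht.walk_eq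
  · rcases le_or_gt u T with hu | hu
    · exact walk_ne_none_of_firstReturn_branch hi h h1 hu
    · obtain ⟨u, rfl⟩ := Nat.exists_eq_add_of_lt hu
      rw [add_assoc, walk_add_of_firstReturn_branch hi h]
      exact ht.walk_ne _ (by omega) (by omega)

theorem escapes_iff_advance {r : Config b} {i : Fin b} (hi : r [] = i.castSucc)
    (h : ¬ Escapes (branch r i)) : Escapes r ↔ Escapes (advance r i) := by
  obtain ⟨T, hT⟩ := exists_firstReturn h
  refine ⟨?_, fun hr ⟨t, h1, h2⟩ => ?_⟩
  · contrapose
    intro hr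
    obtain ⟨t, ht⟩ := exists_firstReturn hr
    exact not_not.2 (hT.add hi ht).returns
  · have hTt : T < t := by
      by_contra hle
      exact walk_ne_none_of_firstReturn_branch hi hT h1 (by omega) h2
    obtain ⟨u, rfl⟩ := Nat.exists_eq_add_of_lt hTt
    rw [add_assoc, walk_add_of_firstReturn_branch hi hT] at h2
    exact hr ⟨u + 1, by omega, h2⟩

theorem final_of_not_escapes_branch {r : Config b} {i : Fin b} (hi : r [] = i.castSucc)
    (h : ¬ Escapes (branch r i)) : final r = final (advance r i) := by
  obtain ⟨T, hT⟩ := exists_firstReturn h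
  by_cases hr : Escapes (advance r i)
  · funext v
    refine final_apply_of_eventually ((escapes_iff_advance hi h).2 hr)
      ((eventually_add_iff (T + 1)).1 ?_)
    filter_upwards [(eventually_add_iff 1).2 (hr.eventually_eq_final v)] with t ht
    rwa [show t + (T + 1) = T + (t + 1) by ring, walk_add_of_firstReturn_branch hi hT]
  · obtain ⟨t, ht⟩ := exists_firstReturn hr
    rw [(hT.add hi ht).final_eq, ht.final_eq]
    obtain ⟨t, rfl⟩ := Nat.exists_eq_add_of_le' ht.one_le
    rw [walk_add_of_firstReturn_branch hi hT]

theorem returnTime_add_le {r : Config b} {i : Fin b} (hi : r [] = i.castSucc) :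
    returnTime (branch r i) + returnTime (advance r i) ≤ returnTime r := by
  by_cases hr : Escapes r
  · simp [hr.returnTime_eq]
  · have h : ¬ Escapes (branch r i) := fun h => hr (escapes_of_branch hi h)
    obtain ⟨T, hT⟩ := exists_firstReturn h
    obtain ⟨t, ht⟩ := exists_firstReturn ((escapes_iff_advance hi h).not.1 hr)
    rw [hT.returnTime_eq, ht.returnTime_eq, (hT.add hi ht).returnTime_eq, Nat.cast_add]

/-! ### Recursion for the number of escapes -/

open Classical in
theorem escapeCount_succ (r : Config b) (n : ℕ) :
    escapeCount r (n + 1) = escapeCount r n + if Escapes (final^[n] r) then 1 else 0 := by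
  simp only [escapeCount, Finset.range_add_one, Finset.filter_insert]
  split_ifs <;> simp

@[simp] theorem escapeCount_zero (r : Config b) : escapeCount r 0 = 0 := by
  simp [escapeCount]

theorem escapeCount_mono (r : Config b) : Monotone (escapeCount r) :=
  monotone_nat_of_le_succ fun n => by rw [escapeCount_succ]; exact Nat.le_add_right _ _

theorem escapeCount_le (r : Config b) (n : ℕ) : escapeCount r n ≤ n := by
  classical
  exact (Finset.card_filter_le _ _).trans_eq (Finset.card_range n)

/-- The total number of steps of the first `n` particles up to their first returns to the root,
infinite if one of them escapes. -/
noncomputable def totalTime (r : Config b) (n : ℕ) : ℕ∞ :=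
  ∑ j ∈ Finset.range n, returnTime (final^[j] r)

theorem totalTime_succ (r : Config b) (n : ℕ) :
    totalTime r (n + 1) = totalTime r n + returnTime (final^[n] r) :=
  Finset.sum_range_succ _ _

theorem totalTime_ne_top_iff {r : Config b} {n : ℕ} :
    totalTime r n ≠ ⊤ ↔ escapeCount r n = 0 := by
  induction n with
  | zero => simp [totalTime]
  | succ n ih =>
    rw [totalTime_succ, escapeCount_succ]
    by_cases h : Escapes (final^[n] r)
    · simp [h, h.returnTime_eq]
    · simpa [h, returnTime_ne_top h] using ih

theorem sum_update_add_one {ι M : Type*} [Fintype ι] [DecidableEq ι] [AddCommMonoid M]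
    (f : ι → ℕ → M) (N : ι → ℕ) (i : ι) {d : M} (h : f i (N i + 1) = f i (N i) + d) :
    ∑ j, f j (Function.update N i (N i + 1) j) = ∑ j, f j (N j) + d := by
  rw [← Finset.sum_erase_add _ _ (Finset.mem_univ i),
    ← Finset.sum_erase_add _ _ (Finset.mem_univ i), Function.update_self, h, ← add_assoc]
  congr 2
  refine Finset.sum_congr rfl fun j hj => ?_
  rw [Function.update_of_ne (Finset.ne_of_mem_erase hj)]

/-- One if the branch number `i` is live, that is if a particle which always returns from the
branches visits it before it returns to the root, and zero if the rotor `k` at `[]` has already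
passed it. -/
def live (k : Fin (b + 1)) (i : Fin b) : ℕ := if k ≤ i.castSucc then 1 else 0

theorem live_le_one (k : Fin (b + 1)) (i : Fin b) : live k i ≤ 1 := by
  unfold live; split_ifs <;> simp

theorem live_zero (i : Fin b) : live 0 i = 1 := if_pos (Fin.zero_le _)

theorem live_last (i : Fin b) : live (Fin.last b) i = 0 :=
  if_neg (Fin.castSucc_lt_last i).not_ge

theorem live_castSucc_self (i : Fin b) : live i.castSucc i = 1 := if_pos le_rfl

theorem live_succ_self (i : Fin b) : live i.succ i = 0 :=
  if_neg i.castSucc_lt_succ.not_ge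

theorem live_succ_of_ne {i j : Fin b} (h : j ≠ i) : live i.succ j = live i.castSucc j := by
  refine if_congr ?_ rfl rfl
  rw [Fin.castSucc_le_castSucc_iff, Fin.succ_le_castSucc_iff, lt_iff_le_and_ne]
  exact and_iff_left h.symm

/-- The configuration `r` arises from `r₀` after `N₀` returns to the root and after `N i` particles
have been sent to the branch number `i`. -/
structure Tracks (r₀ r : Config b) (N₀ : ℕ) (N : Fin b → ℕ) : Prop where
  branch_eq : ∀ i, branch r i = final^[N i] (branch r₀ i)
  count_eq : ∀ i, N i + live (r []) i = N₀ + live (r₀ []) i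

theorem tracks_self (r : Config b) : Tracks r r 0 fun _ => 0 :=
  ⟨fun _ => rfl, fun _ => rfl⟩

theorem Tracks.advance {r₀ r : Config b} {N₀ : ℕ} {N : Fin b → ℕ} {i : Fin b}
    (h : Tracks r₀ r N₀ N) (hi : r [] = i.castSucc) :
    Tracks r₀ (advance r i) N₀ (Function.update N i (N i + 1)) := by
  refine ⟨fun j => ?_, fun j => ?_⟩
  · by_cases hj : j = i
    · subst hj
      rw [branch_advance_self, Function.update_self, Function.iterate_succ_apply', h.branch_eq]
    · rw [branch_advance_of_ne _ hj, Function.update_of_ne hj, h.branch_eq]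
  · rw [advance_nil, ← h.count_eq, hi]
    by_cases hj : j = i
    · subst hj
      rw [Function.update_self, live_succ_self, live_castSucc_self]
    · rw [Function.update_of_ne hj, live_succ_of_ne hj]

theorem Tracks.final_of_last {r₀ r : Config b} {N₀ : ℕ} {N : Fin b → ℕ}
    (h : Tracks r₀ r N₀ N) (hr : r [] = Fin.last b) : Tracks r₀ (final r) (N₀ + 1) N := by
  rw [RotorTree.final_of_last hr]
  refine ⟨fun i => by rw [branch_update_nil, h.branch_eq], fun i => ?_⟩
  have hi := h.count_eq i
  rw [hr, live_last] at hi
  rw [Function.update_self, live_zero]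
  omega

open Classical in
theorem Tracks.exists_final {r₀ r : Config b} {N₀ : ℕ} {N : Fin b → ℕ}
    (h : Tracks r₀ r N₀ N) :
    ∃ N', Tracks r₀ (final r) (N₀ + if Escapes r then 0 else 1) N' ∧
      ∑ i, escapeCount (branch r₀ i) (N' i) =
        ∑ i, escapeCount (branch r₀ i) (N i) + (if Escapes r then 1 else 0) ∧
      ∑ i, totalTime (branch r₀ i) (N' i) + 1 ≤
        ∑ i, totalTime (branch r₀ i) (N i) + returnTime r := by
  induction r using advance_induction generalizing N with
  | last r hr =>
    refine ⟨N, ?_, ?_, ?_⟩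
    · rw [if_neg (not_escapes_of_last hr)]
      exact h.final_of_last hr
    · rw [if_neg (not_escapes_of_last hr), add_zero]
    · rw [(firstReturn_of_last hr).returnTime_eq]
      gcongr
      norm_num
  | castSucc r i hi ih =>
    have hA := h.advance hi
    have hT := sum_update_add_one (fun i => totalTime (branch r₀ i)) N i (totalTime_succ _ _)
    have hE := sum_update_add_one (fun i => escapeCount (branch r₀ i)) N i (escapeCount_succ _ _)
    rw [← h.branch_eq i] at hT hE
    by_cases hs : Escapes (branch r i)
    · have hr := escapes_of_branch hi hs
      refine ⟨Function.update N i (N i + 1), ?_, ?_, ?_⟩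
      · rwa [final_of_escapes_branch hi hs, if_pos hr]
      · rw [if_pos hr, hE, if_pos hs]
      · simp [hr.returnTime_eq]
    · obtain ⟨N', hN', hcount, htime⟩ := ih hA
      simp only [← escapes_iff_advance hi hs, ← final_of_not_escapes_branch hi hs] at hN' hcount
      refine ⟨N', hN', ?_, htime.trans ?_⟩
      · rw [hcount, hE, if_neg hs, add_zero]
      · rw [hT, add_assoc]
        gcongr
        exact returnTime_add_le hi

theorem exists_tracks (r : Config b) (n : ℕ) :
    ∃ N₀ N, Tracks r (final^[n] r) N₀ N ∧ N₀ + escapeCount r n = n ∧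
      ∑ i, escapeCount (branch r i) (N i) = escapeCount r n ∧
      ∑ i, totalTime (branch r i) (N i) + n ≤ totalTime r n := by
  classical
  induction n with
  | zero => exact ⟨0, _, tracks_self r, by simp, by simp, by simp [totalTime]⟩
  | succ n ih =>
    obtain ⟨N₀, N, h, hN₀, hcount, htime⟩ := ih
    obtain ⟨N', h', hcount', htime'⟩ := h.exists_final
    refine ⟨N₀ + if Escapes (final^[n] r) then 0 else 1, N', ?_, ?_, ?_, ?_⟩
    · rwa [Function.iterate_succ_apply']
    · rw [escapeCount_succ]; split_ifs <;> omega
    · rw [hcount', hcount, escapeCount_succ]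
    · calc ∑ i, totalTime (branch r i) (N' i) + ((n + 1 : ℕ) : ℕ∞)
          = (∑ i, totalTime (branch r i) (N' i) + 1) + n := by push_cast; ring
        _ ≤ (∑ i, totalTime (branch r i) (N i) + returnTime (final^[n] r)) + n := by gcongr
        _ = (∑ i, totalTime (branch r i) (N i) + n) + returnTime (final^[n] r) := by ring
        _ ≤ totalTime r (n + 1) := by rw [totalTime_succ]; gcongr

theorem escapeCount_le_sum (r : Config b) (n : ℕ) :
    escapeCount r n ≤
      ∑ i, escapeCount (branch r i) (n - escapeCount r n + live (r []) i) := by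
  obtain ⟨N₀, N, h, hN₀, hcount, -⟩ := exists_tracks r n
  conv_lhs => rw [← hcount]
  refine Finset.sum_le_sum fun i _ => escapeCount_mono _ ?_
  have := h.count_eq i
  omega

theorem sum_le_escapeCount {r : Config b} {n m : ℕ} (hm : escapeCount r n < m) (hmn : m ≤ n) :
    ∑ i, escapeCount (branch r i) (n - m + live (r []) i) ≤ escapeCount r n := by
  obtain ⟨N₀, N, h, hN₀, hcount, -⟩ := exists_tracks r n
  rw [← hcount]
  refine Finset.sum_le_sum fun i _ => escapeCount_mono _ ?_
  have := h.count_eq i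
  have := live_le_one ((final^[n] r) []) i
  omega

/-! ### Escapes from finite trees -/

/-- The number of the first `n` particles that reach the level `h`, when the particles are stopped
at this level. Instead of running the stopped walk, this is defined by the recursion over the
branches which `escapeCount_le_sum` and `sum_le_escapeCount` establish for the escaping
particles. -/
def levelCount : ℕ → Config b → ℕ → ℕ
  | 0, _, n => n
  | h + 1, r, n =>
    Nat.findGreatest (fun m => m ≤ ∑ i, levelCount h (branch r i) (n - m + live (r []) i)) n

theorem levelCount_le (h : ℕ) (r : Config b) (n : ℕ) : levelCount h r n ≤ n := by
  cases h with
  | zero => exact le_rfl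
  | succ h => exact Nat.findGreatest_le n

theorem le_levelCount_succ {h : ℕ} {r : Config b} {n m : ℕ} (hmn : m ≤ n)
    (hm : m ≤ ∑ i, levelCount h (branch r i) (n - m + live (r []) i)) :
    m ≤ levelCount (h + 1) r n :=
  Nat.le_findGreatest hmn hm

theorem levelCount_succ_le_sum (h : ℕ) (r : Config b) (n : ℕ) :
    levelCount (h + 1) r n ≤
      ∑ i, levelCount h (branch r i) (n - levelCount (h + 1) r n + live (r []) i) :=
  Nat.findGreatest_spec
    (P := fun m => m ≤ ∑ i, levelCount h (branch r i) (n - m + live (r []) i))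
    (Nat.zero_le n) (Nat.zero_le _)

theorem sum_lt_of_levelCount_lt {h : ℕ} {r : Config b} {n m : ℕ}
    (hm : levelCount (h + 1) r n < m) (hmn : m ≤ n) :
    ∑ i, levelCount h (branch r i) (n - m + live (r []) i) < m := by
  by_contra! hle
  exact hm.not_ge (le_levelCount_succ hmn hle)

theorem levelCount_mono (h : ℕ) (r : Config b) : Monotone (levelCount h r) := by
  induction h generalizing r with
  | zero => exact monotone_id
  | succ h ih =>
    intro n n' hn
    refine le_levelCount_succ ((levelCount_le _ _ _).trans hn)
      ((levelCount_succ_le_sum h r n).trans (Finset.sum_le_sum fun i _ => ih _ ?_))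
    omega

theorem levelCount_succ_le (h : ℕ) (r : Config b) (n : ℕ) :
    levelCount (h + 1) r n ≤ levelCount h r n := by
  induction h generalizing r n with
  | zero => exact levelCount_le _ _ _
  | succ h ih =>
    exact le_levelCount_succ (levelCount_le _ _ _)
      ((levelCount_succ_le_sum _ r n).trans (Finset.sum_le_sum fun i _ => ih _ _))

theorem levelCount_antitone (r : Config b) (n : ℕ) :
    Antitone fun h => levelCount h r n :=
  antitone_nat_of_succ_le fun h => levelCount_succ_le h r n

theorem escapeCount_le_levelCount (h : ℕ) (r : Config b) (n : ℕ) :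
    escapeCount r n ≤ levelCount h r n := by
  induction h generalizing r n with
  | zero => exact escapeCount_le r n
  | succ h ih =>
    exact le_levelCount_succ (escapeCount_le r n)
      ((escapeCount_le_sum r n).trans (Finset.sum_le_sum fun i _ => ih _ _))

theorem levelCount_succ_eq_zero {h : ℕ} {r : Config b} {n : ℕ} {N : Fin b → ℕ}
    (hN : ∀ i, n + live (r []) i ≤ N i + 1) (h0 : ∀ i, levelCount h (branch r i) (N i) = 0) :
    levelCount (h + 1) r n = 0 := by
  by_contra hpos
  have hsum := levelCount_succ_le_sum h r n
  rw [Finset.sum_eq_zero fun i _ => ?_] at hsum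
  · omega
  · refine Nat.le_zero.1 ((levelCount_mono h _ ?_).trans_eq (h0 i))
    have := hN i
    have := levelCount_le (h + 1) r n
    omega

theorem levelCount_eq_zero_of_totalTime_le (h : ℕ) (r : Config b) (n : ℕ)
    (hr : totalTime r n ≤ h) : levelCount h r n = 0 := by
  induction h generalizing r n with
  | zero =>
    obtain ⟨N₀, N, -, -, -, htime⟩ := exists_tracks r n
    exact Nat.le_zero.1 (Nat.cast_le.1 ((le_add_self.trans htime).trans hr))
  | succ h ih =>
    rcases Nat.eq_zero_or_pos n with rfl | hn
    · exact Nat.le_zero.1 (levelCount_le _ _ _)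
    obtain ⟨N₀, N, hN, hN₀, -, htime⟩ := exists_tracks r n
    have hescape : escapeCount r n = 0 :=
      totalTime_ne_top_iff.1 (ne_top_of_le_ne_top (ENat.natCast_ne_top _) hr)
    refine levelCount_succ_eq_zero (N := N) (fun i => ?_) fun i => ih _ _ ?_
    · have := hN.count_eq i
      have := live_le_one ((final^[n] r) []) i
      omega
    · refine (ENat.add_le_add_iff_right ENat.one_ne_top).1 ?_
      calc totalTime (branch r i) (N i) + 1
          ≤ ∑ i, totalTime (branch r i) (N i) + n := by
            gcongr
            · exact Finset.single_le_sum (f := fun i => totalTime (branch r i) (N i))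
                (fun _ _ => zero_le) (Finset.mem_univ i)
            · exact_mod_cast hn
        _ ≤ h + 1 := htime.trans (by exact_mod_cast hr)

theorem exists_levelCount_eq (r : Config b) (n : ℕ) :
    ∃ h, levelCount h r n = escapeCount r n := by
  suffices ∃ h, levelCount h r n ≤ escapeCount r n from
    this.imp fun h hh => le_antisymm hh (escapeCount_le_levelCount h r n)
  induction n using Nat.strong_induction_on generalizing r with
  | _ n ih =>
    rcases (escapeCount_le r n).eq_or_lt with he | hlt
    · exact ⟨0, he.ge⟩
    rcases Nat.eq_zero_or_pos (escapeCount r n) with h0 | hpos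
    · obtain ⟨s, hs⟩ := ENat.ne_top_iff_exists.1 (totalTime_ne_top_iff.2 h0)
      exact ⟨s, (levelCount_eq_zero_of_totalTime_le s r n hs.ge).le.trans (Nat.zero_le _)⟩
    have hbranch := sum_le_escapeCount (Nat.lt_succ_self (escapeCount r n)) hlt
    generalize escapeCount r n = m at hbranch hlt hpos ⊢
    choose g hg using fun i => ih (n - m.succ + live (r []) i)
      (by have := live_le_one (r []) i; omega) (branch r i)
    refine ⟨Finset.univ.sup g + 1, ?_⟩
    by_contra! hcon
    refine (levelCount_succ_le_sum (Finset.univ.sup g) r n).not_gt (lt_of_le_of_lt ?_ hcon)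
    refine (Finset.sum_le_sum fun i _ => ?_).trans hbranch
    calc levelCount (Finset.univ.sup g) (branch r i)
          (n - levelCount (Finset.univ.sup g + 1) r n + live (r []) i)
        ≤ levelCount (g i) (branch r i) (n - m.succ + live (r []) i) :=
          (levelCount_antitone _ _ (Finset.le_sup (Finset.mem_univ i))).trans
            (levelCount_mono _ _ (by omega))
      _ ≤ escapeCount (branch r i) (n - m.succ + live (r []) i) := hg i

/-! ### The upper bound for the rate of escape -/

theorem levelCount_succ_le_mul_add {h : ℕ} {u C : ℝ} (hu : 0 ≤ u)
    (hC : ∀ (r : Config b) (n : ℕ), (levelCount h r n : ℝ) ≤ u * n + C) (r : Config b) (n : ℕ) :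
    (levelCount (h + 1) r n : ℝ) ≤ b * u / (1 + b * u) * n + b * (u + C) / (1 + b * u) := by
  have hsum := levelCount_succ_le_sum h r n
  have hle := levelCount_le (h + 1) r n
  generalize levelCount (h + 1) r n = m at hsum hle ⊢
  have hm : (m : ℝ) ≤ b * (u * (n - m + 1) + C) := by
    calc (m : ℝ) ≤ ∑ i, (levelCount h (branch r i) (n - m + live (r []) i) : ℝ) := by
          exact_mod_cast hsum
      _ ≤ ∑ _i : Fin b, (u * ((n : ℝ) - m + 1) + C) := by
          refine Finset.sum_le_sum fun i _ => (hC _ _).trans ?_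
          have hlive : (live (r []) i : ℝ) ≤ 1 := by exact_mod_cast live_le_one (r []) i
          push_cast [Nat.cast_sub hle]
          gcongr
      _ = b * (u * (n - m + 1) + C) := by simp [mul_add]
  rw [div_mul_eq_mul_div, ← add_div, le_div_iff₀ (by positivity)]
  linarith

/-- The upper bound for the rate at which particles reach the level `h` that follows from the
recursion for `levelCount`, uniformly in the rotor configuration. -/
noncomputable def levelRate (b : ℕ) : ℕ → ℝ
  | 0 => 1
  | h + 1 => b * levelRate b h / (1 + b * levelRate b h)

theorem levelRate_pos (hb : 0 < b) (h : ℕ) : 0 < levelRate b h := by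
  induction h with
  | zero => exact one_pos
  | succ h ih => unfold levelRate; positivity

theorem exists_levelCount_le (hb : 0 < b) (h : ℕ) :
    ∃ C : ℝ, ∀ (r : Config b) (n : ℕ), (levelCount h r n : ℝ) ≤ levelRate b h * n + C := by
  induction h with
  | zero => exact ⟨0, fun _ n => by simp [levelCount, levelRate]⟩
  | succ h ih =>
    obtain ⟨C, hC⟩ := ih
    exact ⟨_, levelCount_succ_le_mul_add (levelRate_pos hb h).le hC⟩

theorem inv_levelRate (hb : 2 ≤ b) (h : ℕ) :
    (levelRate b h)⁻¹ = b / (b - 1) - (1 / (b - 1)) * (1 / b) ^ h := by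
  have hb' : (2 : ℝ) ≤ b := by exact_mod_cast hb
  have h1 : (b : ℝ) - 1 ≠ 0 := by linarith
  induction h with
  | zero => rw [levelRate]; field_simp
  | succ h ih =>
    have hpos := levelRate_pos (by omega : 0 < b) h
    have hrec : (levelRate b (h + 1))⁻¹ = 1 + (levelRate b h)⁻¹ / b := by
      rw [levelRate]; field_simp; ring
    rw [hrec, ih, pow_succ]
    field_simp
    rw [add_comm]
    ring

theorem tendsto_levelRate (hb : 2 ≤ b) :
    Tendsto (levelRate b) atTop (𝓝 (((b : ℝ) - 1) / b)) := by
  have hb' : (2 : ℝ) ≤ b := by exact_mod_cast hb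
  have hpow : Tendsto (fun h : ℕ => ((1 : ℝ) / b) ^ h) atTop (𝓝 0) :=
    tendsto_pow_atTop_nhds_zero_of_lt_one (by positivity)
      ((div_lt_one (by linarith)).2 (by linarith))
  have hinv : Tendsto (fun h => (levelRate b h)⁻¹) atTop (𝓝 ((b : ℝ) / (b - 1))) := by
    simp only [inv_levelRate hb]
    simpa using tendsto_const_nhds.sub (hpow.const_mul (1 / ((b : ℝ) - 1)))
  simpa using hinv.inv₀ (div_ne_zero (by linarith) (by linarith))

theorem eventually_escapeCount_div_lt (hb : 2 ≤ b) (r : Config b) {c : ℝ}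
    (hc : ((b : ℝ) - 1) / b < c) : ∀ᶠ n : ℕ in atTop, (escapeCount r n : ℝ) / n < c := by
  obtain ⟨h, hh⟩ := ((tendsto_levelRate hb).eventually (gt_mem_nhds hc)).exists
  obtain ⟨C, hC⟩ := exists_levelCount_le (by omega : 0 < b) h
  have hlim : Tendsto (fun n : ℕ => levelRate b h + C / n) atTop (𝓝 (levelRate b h)) := by
    simpa using tendsto_const_nhds.add (tendsto_const_div_atTop_nhds_zero_nat C)
  filter_upwards [hlim.eventually (gt_mem_nhds hh), eventually_gt_atTop 0] with n hn hn0
  have hn0' : (0 : ℝ) < n := by exact_mod_cast hn0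
  refine lt_of_le_of_lt ?_ hn
  rw [div_le_iff₀ hn0', add_mul, div_mul_cancel₀ _ hn0'.ne']
  calc (escapeCount r n : ℝ) ≤ levelCount h r n := by
        exact_mod_cast escapeCount_le_levelCount h r n
    _ ≤ levelRate b h * n + C := hC r n

/-! ### Lower bounds for the rate of escape -/

/-- Up to a bounded error, at least `ℓ * n` of the first `n` particles escape. -/
def RateGE (r : Config b) (ℓ : ℝ) : Prop :=
  ∃ C : ℝ, ∀ n : ℕ, ℓ * n ≤ escapeCount r n + C

theorem rateGE_zero (r : Config b) : RateGE r 0 := ⟨0, fun n => by simp⟩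

theorem RateGE.of_branch {r : Config b} {ℓ : Fin b → ℝ} (h0 : ∀ i, 0 ≤ ℓ i)
    (h : ∀ i, RateGE (branch r i) (ℓ i)) : RateGE r ((∑ i, ℓ i) / (1 + ∑ i, ℓ i)) := by
  choose C hC using h
  have hs : 0 ≤ ∑ i, ℓ i := Finset.sum_nonneg fun i _ => h0 i
  have hC0 : 0 ≤ ∑ i, C i := Finset.sum_nonneg fun i _ => by simpa using hC i 0
  refine ⟨(∑ i, ℓ i) + ∑ i, C i, fun n => ?_⟩
  have hmul := mul_nonneg hs hC0
  have hsq := mul_nonneg hs hs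
  rw [div_mul_eq_mul_div, div_le_iff₀ (by linarith)]
  rcases (escapeCount_le r n).eq_or_lt with he | hlt
  · rw [he]
    linarith [Nat.cast_nonneg (α := ℝ) n]
  have hbranch := sum_le_escapeCount (Nat.lt_succ_self _) hlt
  have hle : escapeCount r n + 1 ≤ n := hlt
  generalize escapeCount r n = e at hbranch hle ⊢
  have hsum : (∑ i, ℓ i) * ((n : ℝ) - (e + 1)) ≤ e + ∑ i, C i := by
    calc (∑ i, ℓ i) * ((n : ℝ) - (e + 1)) = ∑ i, ℓ i * ((n : ℝ) - (e + 1)) :=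
          Finset.sum_mul _ _ _
      _ ≤ ∑ i, ((escapeCount (branch r i) (n - e.succ + live (r []) i) : ℝ) + C i) := by
          refine Finset.sum_le_sum fun i _ => le_trans ?_ (hC i _)
          refine mul_le_mul_of_nonneg_left ?_ (h0 i)
          push_cast [Nat.cast_sub hle]
          linarith [Nat.cast_nonneg (α := ℝ) (live (r []) i)]
      _ ≤ e + ∑ i, C i := by
          rw [Finset.sum_add_distrib]
          gcongr
          exact_mod_cast hbranch
  linarith

/-- The lower rate of escape. -/
noncomputable def rate (r : Config b) : ℝ≥0∞ :=
  liminf (fun n : ℕ => (escapeCount r n : ℝ≥0∞) / n) atTop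

theorem rate_le_one (r : Config b) : rate r ≤ 1 :=
  liminf_le_of_frequently_le' <| Frequently.of_forall fun n =>
    ENNReal.div_le_of_le_mul (by rw [one_mul]; exact_mod_cast escapeCount_le r n)

theorem RateGE.le_rate {r : Config b} {ℓ : ℝ} (h : RateGE r ℓ) : ENNReal.ofReal ℓ ≤ rate r := by
  obtain ⟨C, hC⟩ := h
  refine le_of_forall_lt fun c hc => ?_
  obtain ⟨c', hcc', hc'⟩ := exists_between hc
  refine hcc'.trans_le (le_liminf_of_le (by isBoundedDefault) ?_)
  lift c' to ℝ≥0 using hc'.ne_top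
  have hlt : (c' : ℝ) < ℓ := ENNReal.coe_lt_ofReal.1 hc'
  have hlim : Tendsto (fun n : ℕ => ℓ - C / n) atTop (𝓝 ℓ) := by
    simpa using tendsto_const_nhds.sub (tendsto_const_div_atTop_nhds_zero_nat C)
  filter_upwards [hlim.eventually (lt_mem_nhds hlt), eventually_gt_atTop 0] with n hn hn0
  have hn0' : (0 : ℝ) < n := by exact_mod_cast hn0
  rw [ENNReal.le_div_iff_mul_le (Or.inl (by exact_mod_cast hn0.ne')) (Or.inl (by simp))]
  have hle : (c' : ℝ) * n ≤ escapeCount r n := by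
    have hmul := mul_lt_mul_of_pos_right hn hn0'
    rw [sub_mul, div_mul_cancel₀ _ hn0'.ne'] at hmul
    linarith [hC n]
  exact_mod_cast hle

theorem rateGE_of_lt_rate {r : Config b} {ℓ : ℝ≥0} (h : (ℓ : ℝ≥0∞) < rate r) : RateGE r ℓ := by
  obtain ⟨N, hN⟩ := eventually_atTop.1 (eventually_lt_of_lt_liminf h)
  have hC : 0 ≤ (ℓ : ℝ) * (N + 1 : ℕ) := by positivity
  refine ⟨ℓ * (N + 1 : ℕ), fun n => ?_⟩
  rcases lt_or_ge n (N + 1) with hn | hn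
  · have hle : (ℓ : ℝ) * n ≤ ℓ * (N + 1 : ℕ) := by gcongr
    linarith [Nat.cast_nonneg (α := ℝ) (escapeCount r n)]
  · have hle := (hN n (by omega)).le
    rw [ENNReal.le_div_iff_mul_le (Or.inl (by exact_mod_cast (by omega : n ≠ 0)))
      (Or.inl (by simp))] at hle
    have hle' : (ℓ : ℝ) * n ≤ escapeCount r n := by exact_mod_cast hle
    linarith

theorem ofReal_div_one_add_le_rate (r : Config b) :
    ENNReal.ofReal ((∑ i, (rate (branch r i)).toReal) / (1 + ∑ i, (rate (branch r i)).toReal)) ≤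
      rate r := by
  set s := ∑ i, (rate (branch r i)).toReal with hs
  have : 0 ≤ s := Finset.sum_nonneg fun i _ => ENNReal.toReal_nonneg
  have hbelow : ∀ t : ℝ≥0, t < 1 → ENNReal.ofReal (t * s / (1 + t * s)) ≤ rate r := by
    intro t ht
    rw [hs, Finset.mul_sum]
    refine (RateGE.of_branch (fun i => by positivity) fun i => ?_).le_rate
    have hne : rate (branch r i) ≠ ⊤ := ne_top_of_le_ne_top ENNReal.one_ne_top (rate_le_one _)
    by_cases hi : rate (branch r i) = 0
    · simpa [hi] using rateGE_zero (branch r i)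
    · refine rateGE_of_lt_rate (ℓ := t * (rate (branch r i)).toNNReal) ?_
      rw [ENNReal.coe_mul, ENNReal.coe_toNNReal hne]
      simpa using ENNReal.mul_lt_mul_left hi hne (ENNReal.coe_lt_coe.2 ht)
  have hlim : Tendsto (fun t : ℝ≥0 => ENNReal.ofReal (t * s / (1 + t * s))) (𝓝[<] 1)
      (𝓝 (ENNReal.ofReal (s / (1 + s)))) := by
    have hcont : ContinuousAt (fun t : ℝ≥0 => (t : ℝ) * s / (1 + t * s)) 1 := by
      refine ContinuousAt.div (by fun_prop) (by fun_prop) ?_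
      rw [NNReal.coe_one, one_mul]
      positivity
    simpa using ENNReal.tendsto_ofReal (hcont.tendsto.mono_left nhdsWithin_le_nhds)
  have : (𝓝[<] (1 : ℝ≥0)).NeBot := nhdsLT_neBot_of_exists_lt ⟨0, one_pos⟩
  exact le_of_tendsto hlim (eventually_nhdsWithin_of_forall hbelow)

/-- Think of `(rate r)⁻¹` as the effective resistance of the tree: an edge of resistance one in
series with the branches in parallel. -/
theorem inv_rate_le_one_add_inv_sum (r : Config b) :
    (rate r)⁻¹ ≤ 1 + (∑ i, rate (branch r i))⁻¹ := by
  have hne : ∀ i, rate (branch r i) ≠ ⊤ := fun i =>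
    ne_top_of_le_ne_top ENNReal.one_ne_top (rate_le_one _)
  have hle := ofReal_div_one_add_le_rate r
  rw [← ENNReal.toReal_sum fun i _ => hne i] at hle
  have hsum : ∑ i, rate (branch r i) ≠ ⊤ := ENNReal.sum_ne_top.2 fun i _ => hne i
  generalize ∑ i, rate (branch r i) = s at hle hsum ⊢
  lift s to ℝ≥0 using hsum
  rw [ENNReal.coe_toReal] at hle
  rcases eq_or_ne s 0 with rfl | hs0
  · simp
  · have hdiv : (s : ℝ) / (1 + s) = ((s / (1 + s) : ℝ≥0) : ℝ) := by push_cast; rfl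
    rw [hdiv, ENNReal.ofReal_coe_nnreal] at hle
    refine (ENNReal.inv_le_inv.2 hle).trans_eq ?_
    rw [← ENNReal.coe_inv (by positivity), ← ENNReal.coe_inv hs0, ← ENNReal.coe_one,
      ← ENNReal.coe_add]
    congr 1
    field_simp
    rw [add_comm]

theorem inv_rate_le_one_add (r : Config b) (i : Fin b) :
    (rate r)⁻¹ ≤ 1 + (rate (branch r i))⁻¹ := by
  refine (inv_rate_le_one_add_inv_sum r).trans ?_
  gcongr
  exact Finset.single_le_sum (f := fun i => rate (branch r i)) (fun _ _ => zero_le)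
    (Finset.mem_univ i)

theorem inv_sum_le_sum_inv_div_sq {ι : Type*} [Fintype ι] [Nonempty ι] (x : ι → ℝ≥0∞) :
    (∑ i, x i)⁻¹ ≤ (∑ i, (x i)⁻¹) / (Fintype.card ι : ℝ≥0∞) ^ 2 := by
  by_cases h0 : ∃ i, x i = 0
  · obtain ⟨i, hi⟩ := h0
    have hsum : ∑ i, (x i)⁻¹ = ⊤ := ENNReal.sum_eq_top.2 ⟨i, Finset.mem_univ _, by simp [hi]⟩
    rw [hsum, ENNReal.top_div_of_ne_top (by simp)]
    exact le_top
  by_cases htop : ∃ i, x i = ⊤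
  · obtain ⟨i, hi⟩ := htop
    rw [ENNReal.sum_eq_top.2 ⟨i, Finset.mem_univ _, hi⟩, ENNReal.inv_top]
    exact zero_le
  push Not at h0 htop
  lift x to ι → ℝ≥0 using htop
  have hx : ∀ i, x i ≠ 0 := fun i => by simpa using h0 i
  have hs : 0 < ∑ i, x i :=
    Finset.sum_pos (fun i _ => pos_iff_ne_zero.2 (hx i)) Finset.univ_nonempty
  have hcauchy := Finset.sum_sq_le_sum_mul_sum_of_sq_le_mul Finset.univ
    (r := fun _ : ι => (1 : ℝ≥0)) (f := x) (g := fun i => (x i)⁻¹) (fun _ _ => zero_le)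
    (fun _ _ => zero_le) fun i _ => by rw [mul_inv_cancel₀ (hx i), one_pow]
  simp only [← ENNReal.coe_inv (hx _)]
  rw [← ENNReal.ofNNReal_finsetSum, ← ENNReal.ofNNReal_finsetSum, ← ENNReal.coe_inv hs.ne',
    ← ENNReal.coe_natCast, ← ENNReal.coe_pow, ← ENNReal.coe_div (by positivity),
    ENNReal.coe_le_coe, le_div_iff₀ (by positivity), inv_mul_le_iff₀ hs]
  simpa using hcauchy

theorem inv_rate_le_one_add_sum [NeZero b] (r : Config b) :
    (rate r)⁻¹ ≤ 1 + (∑ i, (rate (branch r i))⁻¹) / (b : ℝ≥0∞) ^ 2 := by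
  refine (inv_rate_le_one_add_inv_sum r).trans ?_
  gcongr
  simpa using inv_sum_le_sum_inv_div_sq fun i => rate (branch r i)

theorem rate_le (hb : 2 ≤ b) (r : Config b) : rate r ≤ ENNReal.ofReal (((b : ℝ) - 1) / b) := by
  have hb' : (2 : ℝ) ≤ b := by exact_mod_cast hb
  have h0 : 0 ≤ ((b : ℝ) - 1) / b := div_nonneg (by linarith) (by linarith)
  refine le_of_forall_gt fun c hc => ?_
  obtain ⟨c', hc', hcc'⟩ := exists_between hc
  refine lt_of_le_of_lt ?_ hcc'
  lift c' to ℝ≥0 using hcc'.ne_top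
  have hlt : ((b : ℝ) - 1) / b < c' := (ENNReal.ofReal_lt_coe_iff h0).1 hc'
  refine liminf_le_of_frequently_le' (Eventually.frequently ?_)
  filter_upwards [eventually_escapeCount_div_lt hb r hlt, eventually_gt_atTop 0] with n hn hn0
  refine ENNReal.div_le_of_le_mul ?_
  rw [div_lt_iff₀ (by exact_mod_cast hn0)] at hn
  exact_mod_cast hn.le

theorem tendsto_of_le_rate (hb : 2 ≤ b) (r : Config b)
    (h : ENNReal.ofReal (((b : ℝ) - 1) / b) ≤ rate r) :
    Tendsto (fun n : ℕ => (escapeCount r n : ℝ) / n) atTop (𝓝 (((b : ℝ) - 1) / b)) := by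
  refine tendsto_order.2 ⟨fun c hc => ?_, fun c hc => eventually_escapeCount_div_lt hb r hc⟩
  rcases lt_or_ge c 0 with hneg | hc0
  · exact Eventually.of_forall fun n => hneg.trans_le (by positivity)
  have hlt : ENNReal.ofReal c < rate r :=
    ((ENNReal.ofReal_lt_ofReal_iff_of_nonneg hc0).2 hc).trans_le h
  filter_upwards [eventually_lt_of_lt_liminf hlt, eventually_gt_atTop 0] with n hn hn0
  rw [← ENNReal.ofReal_natCast, ← ENNReal.ofReal_natCast,
    ← ENNReal.ofReal_div_of_pos (by exact_mod_cast hn0)] at hn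
  exact (ENNReal.ofReal_lt_ofReal_iff_of_nonneg hc0).1 hn

/-! ### Flows on the live vertices -/

/-- The number of vertices of level `h` that are connected to `[]` by live edges, divided by
`m ^ h`. It is the strength of the flow which sends `m⁻¹ ^ h` to each of these vertices. -/
noncomputable def flow (m : ℝ) : ℕ → Config b → ℝ
  | 0, _ => 1
  | h + 1, r => m⁻¹ * ∑ i, (live (r []) i : ℝ) * flow m h (branch r i)

/-- The energy of the flow of strength `flow m h r` that is uniform on the vertices of level `h`
connected to `[]` by live edges, where all edges have resistance one. -/
noncomputable def energy (m : ℝ) : ℕ → Config b → ℝ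
  | 0, _ => 1
  | h + 1, r =>
    flow m (h + 1) r ^ 2 + m⁻¹ ^ 2 * ∑ i, (live (r []) i : ℝ) * energy m h (branch r i)

theorem energy_nonneg (m : ℝ) (h : ℕ) (r : Config b) : 0 ≤ energy m h r := by
  induction h generalizing r with
  | zero => exact zero_le_one
  | succ h ih =>
    exact add_nonneg (sq_nonneg _) (mul_nonneg (sq_nonneg _)
      (Finset.sum_nonneg fun i _ => mul_nonneg (Nat.cast_nonneg _) (ih _)))

theorem sum_live_mul_energy_nonneg (m : ℝ) (h : ℕ) (r : Config b) :
    0 ≤ ∑ i, (live (r []) i : ℝ) * energy m h (branch r i) :=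
  Finset.sum_nonneg fun _ _ => mul_nonneg (Nat.cast_nonneg _) (energy_nonneg _ _ _)

theorem sq_flow_le_energy (m : ℝ) (h : ℕ) (r : Config b) : flow m h r ^ 2 ≤ energy m h r := by
  cases h with
  | zero => simp [flow, energy]
  | succ h =>
    exact le_add_of_nonneg_right (mul_nonneg (sq_nonneg _) (sum_live_mul_energy_nonneg m h r))

theorem sub_mul_sq_sum_flow_le {m : ℝ} {h n : ℕ} {r : Config b}
    (hbranch : ∀ i k, k * flow m h (branch r i) ^ 2 ≤
      levelCount h (branch r i) k * energy m h (branch r i))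
    (hlt : levelCount (h + 1) r n < n) :
    ((n : ℝ) - levelCount (h + 1) r n) * (∑ i, (live (r []) i : ℝ) * flow m h (branch r i)) ^ 2 ≤
      levelCount (h + 1) r n * ∑ i, (live (r []) i : ℝ) * energy m h (branch r i) := by
  have hsum := Nat.le_of_lt_succ (sum_lt_of_levelCount_lt (Nat.lt_succ_self _) hlt)
  generalize levelCount (h + 1) r n = k at hsum hlt ⊢
  have hk : (0 : ℝ) ≤ (n : ℝ) - k := sub_nonneg.2 (by exact_mod_cast hlt.le)
  have hterm (i : Fin b) : (√((n : ℝ) - k) * (live (r []) i * flow m h (branch r i))) ^ 2 ≤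
      levelCount h (branch r i) (n - (k + 1) + live (r []) i) *
        (live (r []) i * energy m h (branch r i)) := by
    rcases Nat.le_one_iff_eq_zero_or_eq_one.1 (live_le_one (r []) i) with hl | hl
    · simp [hl]
    · have hi := hbranch i (n - k)
      rw [Nat.cast_sub hlt.le] at hi
      rw [hl, show n - (k + 1) + 1 = n - k by omega, Nat.cast_one, one_mul, one_mul, mul_pow,
        Real.sq_sqrt hk]
      exact hi
  have hcauchy := Finset.sum_sq_le_sum_mul_sum_of_sq_le_mul Finset.univ
    (fun i _ => Nat.cast_nonneg (levelCount h (branch r i) (n - (k + 1) + live (r []) i)))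
    (fun i _ => mul_nonneg (Nat.cast_nonneg (live (r []) i)) (energy_nonneg m h (branch r i)))
    fun i _ => hterm i
  rw [← Finset.mul_sum, mul_pow, Real.sq_sqrt hk] at hcauchy
  refine hcauchy.trans (mul_le_mul_of_nonneg_right ?_ (sum_live_mul_energy_nonneg m h r))
  exact_mod_cast hsum

/-- Thomson's principle: a flow bounds the effective conductance, here `levelCount h r n / n`, from
below by the square of its strength divided by its energy. -/
theorem mul_sq_flow_le (m : ℝ) (h : ℕ) (r : Config b) (n : ℕ) :
    n * flow m h r ^ 2 ≤ levelCount h r n * energy m h r := by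
  induction h generalizing r n with
  | zero => simp [flow, energy, levelCount]
  | succ h ih =>
    rcases (levelCount_le (h + 1) r n).eq_or_lt with he | hlt
    · rw [he]
      exact mul_le_mul_of_nonneg_left (sq_flow_le_energy m _ _) (Nat.cast_nonneg n)
    have hstep := mul_le_mul_of_nonneg_left
      (sub_mul_sq_sum_flow_le (fun i k => ih (branch r i) k) hlt) (sq_nonneg m⁻¹)
    rw [energy, flow, mul_pow]
    linarith

/-! ### The law of the branches -/

theorem comap_comp_le_iSup_comap {ι κ : Type*} {Ω : ι → Type*} {mΩ : ∀ i, MeasurableSpace (Ω i)}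
    (g : κ → ι) :
    MeasurableSpace.pi.comap (fun (ω : ∀ i, Ω i) k => ω (g k)) ≤
      ⨆ i ∈ Set.range g, (mΩ i).comap fun ω : ∀ i, Ω i => ω i := by
  simp only [MeasurableSpace.pi, MeasurableSpace.comap_iSup, MeasurableSpace.comap_comp]
  exact iSup_le fun k => le_iSup₂_of_le (g k) (Set.mem_range_self k) le_rfl

theorem indepFun_comp_of_disjoint_range {ι α κ : Type*} {Ω : ι → Type*}
    {mΩ : ∀ i, MeasurableSpace (Ω i)} (P : ∀ i, Measure (Ω i)) [∀ i, IsProbabilityMeasure (P i)]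
    {f : α → ι} {g : κ → ι} (hfg : Disjoint (Set.range f) (Set.range g)) :
    IndepFun (fun ω a => ω (f a)) (fun ω k => ω (g k)) (Measure.infinitePi P) := by
  have hindep : iIndepFun (fun i (ω : ∀ i, Ω i) => ω i) (Measure.infinitePi P) :=
    iIndepFun_infinitePi (X := fun _ x => x) fun _ => measurable_id
  have h := indep_iSup_of_disjoint (fun i => (measurable_pi_apply i).comap_le) hindep hfg
  exact indep_of_indep_of_le_left
    (indep_of_indep_of_le_right h (comap_comp_le_iSup_comap g)) (comap_comp_le_iSup_comap f)

/-- The law of a configuration of independent rotors with common law `μ`. -/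
noncomputable abbrev law (b : ℕ) (μ : Measure (Fin (b + 1))) : Measure (Config b) :=
  Measure.infinitePi fun _ => μ

theorem measurable_branch (i : Fin b) : Measurable fun r : Config b => branch r i :=
  measurable_pi_lambda _ fun _ => measurable_pi_apply _

section Law

variable (μ : Measure (Fin (b + 1))) [IsProbabilityMeasure μ]

theorem measurePreserving_branches :
    MeasurePreserving (fun r : Config b => fun i => branch r i) (law b μ)
      (Measure.pi fun _ : Fin b => law b μ) := by
  refine ⟨measurable_pi_lambda _ measurable_branch, ?_⟩
  have hinj : Function.Injective fun p : Fin b × List (Fin b) => p.2 ++ [p.1] := by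
    rintro ⟨i, u⟩ ⟨j, w⟩ h
    simpa [and_comm] using h
  rw [← Measure.infinitePi_eq_pi, ← Measure.infinitePi_map_curry fun _ _ => μ,
    ← Measure.map_infinitePi_infinitePi_of_inj (P := fun _ => μ) hinj,
    Measure.map_map (by fun_prop) (by fun_prop)]
  rfl

theorem measurePreserving_branch (i : Fin b) :
    MeasurePreserving (fun r : Config b => branch r i) (law b μ) (law b μ) :=
  (measurePreserving_eval (fun _ : Fin b => law b μ) i).comp (measurePreserving_branches μ)

theorem iIndepFun_branch : iIndepFun (fun i (r : Config b) => branch r i) (law b μ) := by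
  rw [iIndepFun_iff_map_fun_eq_pi_map fun i => (measurable_branch i).aemeasurable]
  simp only [(measurePreserving_branch μ _).map_eq]
  exact (measurePreserving_branches μ).map_eq

theorem indepFun_root_branches :
    IndepFun (fun r : Config b => r []) (fun r i => branch r i) (law b μ) := by
  have hdisj : Disjoint (Set.range fun _ : Unit => ([] : List (Fin b)))
      (Set.range fun p : Fin b × List (Fin b) => p.2 ++ [p.1]) := by
    simp
  exact (indepFun_comp_of_disjoint_range (fun _ => μ) hdisj).comp
    (φ := fun x : Unit → Fin (b + 1) => x ())
    (ψ := fun (x : Fin b × List (Fin b) → Fin (b + 1)) i u => x (i, u))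
    (by fun_prop) (by fun_prop)

theorem measurePreserving_split :
    MeasurePreserving (fun r : Config b => (r [], fun i => branch r i)) (law b μ)
      (μ.prod (Measure.pi fun _ : Fin b => law b μ)) := by
  have hroot := measurePreserving_eval_infinitePi (fun _ : List (Fin b) => μ) []
  have hbranches := measurePreserving_branches μ
  refine ⟨hroot.measurable.prodMk hbranches.measurable, ?_⟩
  rw [(indepFun_root_branches μ).map_prod_eq_prod_map_map hroot.aemeasurable
    hbranches.aemeasurable, hroot.map_eq, hbranches.map_eq]

end Law

/-! ### Measurability -/

theorem measurable_levelCount (h n : ℕ) : Measurable fun r : Config b => levelCount h r n := by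
  induction h generalizing n with
  | zero => exact measurable_const
  | succ h ih =>
    refine measurable_findGreatest fun k _ => measurableSet_le measurable_const ?_
    refine Finset.measurable_sum _ fun i _ => ?_
    have hjoint : Measurable fun p : Config b × ℕ => levelCount h p.1 p.2 :=
      measurable_from_prod_countable_left ih
    refine hjoint.comp ((measurable_branch i).prodMk ?_)
    exact (Measurable.of_discrete (f := fun k => n - _ + live k i)).comp (measurable_pi_apply [])

theorem measurable_escapeCount (n : ℕ) : Measurable fun r : Config b => escapeCount r n := by
  refine measurable_of_Iic fun k => ?_
  have hIic : (fun r : Config b => escapeCount r n) ⁻¹' Set.Iic k =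
      ⋃ h, {r | levelCount h r n ≤ k} := by
    ext r
    simp only [Set.mem_preimage, Set.mem_Iic, Set.mem_iUnion, Set.mem_ofPred_eq]
    refine ⟨fun hr => ?_, fun ⟨h, hh⟩ => (escapeCount_le_levelCount h r n).trans hh⟩
    obtain ⟨h, hh⟩ := exists_levelCount_eq r n
    exact ⟨h, hh.trans_le hr⟩
  rw [hIic]
  exact MeasurableSet.iUnion fun h => measurableSet_le (measurable_levelCount h n) measurable_const

theorem measurable_rate : Measurable fun r : Config b => rate r :=
  Measurable.liminf fun n => ((Measurable.of_discrete (f := fun k : ℕ => (k : ℝ≥0∞))).comp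
    (measurable_escapeCount n)).div_const _

theorem measurable_live (i : Fin b) : Measurable fun r : Config b => (live (r []) i : ℝ) :=
  (Measurable.of_discrete (f := fun k => (live k i : ℝ))).comp (measurable_pi_apply [])

theorem measurable_flow (m : ℝ) (h : ℕ) : Measurable fun r : Config b => flow m h r := by
  induction h with
  | zero => exact measurable_const
  | succ h ih =>
    exact (Finset.measurable_sum _ fun i _ =>
      (measurable_live i).mul (ih.comp (measurable_branch i))).const_mul _

theorem measurable_energy (m : ℝ) (h : ℕ) : Measurable fun r : Config b => energy m h r := by
  induction h with
  | zero => exact measurable_const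
  | succ h ih =>
    exact ((measurable_flow m (h + 1)).pow_const 2).add ((Finset.measurable_sum _ fun i _ =>
      (measurable_live i).mul (ih.comp (measurable_branch i))).const_mul _)

/-! ### No escapes when live vertices are rare -/

theorem sum_live (k : Fin (b + 1)) : ∑ i : Fin b, live k i = b - k := by
  have hlt := Fin.card_filter_val_lt (n := b) (m := k)
  have hsplit := Finset.card_filter_add_card_filter_not (s := (Finset.univ : Finset (Fin b)))
    (fun i => (i : ℕ) < k)
  simp only [Finset.card_univ, Fintype.card_fin, not_lt] at hsplit
  simp only [live, ← Finset.card_filter, Fin.le_def, Fin.val_castSucc]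
  have := k.isLt
  omega

/-- The mean number of live children of a vertex whose rotor has law `μ`. -/
noncomputable def meanLive (μ : Measure (Fin (b + 1))) : ℝ := ∫ k, ∑ i : Fin b, (live k i : ℝ) ∂μ

theorem meanLive_eq (μ : Measure (Fin (b + 1))) [IsProbabilityMeasure μ] :
    meanLive μ = b - ∫ k, ((k : ℕ) : ℝ) ∂μ := by
  have hsum : ∀ k : Fin (b + 1), ∑ i : Fin b, (live k i : ℝ) = b - (k : ℕ) := fun k => by
    rw [← Nat.cast_sub (Nat.lt_succ_iff.1 k.isLt), ← sum_live, Nat.cast_sum]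
  simp only [meanLive, hsum]
  rw [integral_sub (integrable_const _) Integrable.of_finite]
  simp

-- The line joins the points `0` and `2` of the graph of the strictly convex map `N ↦ q ^ N`,
-- shifted down so that it meets the graph only at `1`.
theorem lt_pow_of_ne_one {q : ℝ} (hq0 : 0 ≤ q) (hq1 : q < 1) {N : ℕ} (hN : N ≠ 1) :
    q + (1 - q ^ 2) / 2 * (1 - N) < q ^ N := by
  have hgap : 0 < (1 - q) ^ 2 := by have := sub_pos.2 hq1; positivity
  obtain rfl | hN2 : N = 0 ∨ 2 ≤ N := by omega
  · rw [Nat.cast_zero, pow_zero]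
    linarith
  · induction N, hN2 using Nat.le_induction with
    | base =>
      push_cast
      linarith
    | succ N hN2 ih =>
      have hle : q ^ N ≤ q := pow_le_of_le_one hq0 hq1.le (by omega)
      have hdrop : q ^ N * (1 - q) ≤ q * (1 - q) :=
        mul_le_mul_of_nonneg_right hle (sub_pos.2 hq1).le
      specialize ih (by omega)
      rw [pow_succ q N]
      push_cast
      linarith

theorem eq_zero_of_sum_mul_pow_le {ι : Type*} [Fintype ι] {p : ι → ℝ} {N : ι → ℕ}
    (hp : ∀ i, 0 ≤ p i) (hsum : ∑ i, p i = 1) (hmean : ∑ i, p i * N i ≤ 1) {q : ℝ} (hq0 : 0 ≤ q)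
    (hq1 : q < 1) (hq : ∑ i, p i * q ^ N i ≤ q) {i : ι} (hi : N i ≠ 1) : p i = 0 := by
  have hterm : ∀ j, 0 ≤ q ^ N j - (q + (1 - q ^ 2) / 2 * (1 - N j)) := fun j => by
    rcases eq_or_ne (N j) 1 with hj | hj
    · simp [hj]
    · exact (sub_pos.2 (lt_pow_of_ne_one hq0 hq1 hj)).le
  have hnonpos : ∑ j, p j * (q ^ N j - (q + (1 - q ^ 2) / 2 * (1 - N j))) ≤ 0 := by
    have hexpand : ∑ j, p j * (q ^ N j - (q + (1 - q ^ 2) / 2 * (1 - N j))) =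
        ∑ j, p j * q ^ N j - q - (1 - q ^ 2) / 2 * (1 - ∑ j, p j * N j) := by
      have hsplit : ∀ j, p j * (q ^ N j - (q + (1 - q ^ 2) / 2 * (1 - N j))) =
          p j * q ^ N j - p j * q - (1 - q ^ 2) / 2 * (p j - p j * N j) := fun j => by ring
      simp only [hsplit, Finset.sum_sub_distrib, ← Finset.mul_sum, ← Finset.sum_mul, hsum, one_mul]
    have := mul_nonneg (by nlinarith : 0 ≤ (1 - q ^ 2) / 2) (sub_nonneg.2 hmean)
    linarith
  have hnonneg := fun j (_ : j ∈ Finset.univ) => mul_nonneg (hp j) (hterm j)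
  have hzero := (Finset.sum_eq_zero_iff_of_nonneg hnonneg).1
    (hnonpos.antisymm (Finset.sum_nonneg hnonneg)) i (Finset.mem_univ i)
  exact (mul_eq_zero.1 hzero).resolve_right (sub_pos.2 (lt_pow_of_ne_one hq0 hq1 hi)).ne'

theorem escapeCount_succ_eq_zero {r : Config b} {n : ℕ}
    (hlive : ∀ i, r [] ≤ i.castSucc → escapeCount (branch r i) (n + 1) = 0)
    (hall : ∀ i, escapeCount (branch r i) n = 0) : escapeCount r (n + 1) = 0 := by
  by_contra hpos
  refine hpos (Nat.le_zero.1 ((escapeCount_le_sum r (n + 1)).trans_eq ?_))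
  refine Finset.sum_eq_zero fun i _ => Nat.le_zero.1 ?_
  by_cases hi : r [] ≤ i.castSucc
  · rw [live, if_pos hi]
    exact (escapeCount_mono _ (by omega)).trans_eq (hlive i hi)
  · rw [live, if_neg hi]
    exact (escapeCount_mono _ (by omega)).trans_eq (hall i)

section Law

variable (μ : Measure (Fin (b + 1))) [IsProbabilityMeasure μ]

theorem law_forall_live_branch_mem {S : Set (Config b)} (hS : MeasurableSet S) :
    law b μ {r | ∀ i, r [] ≤ i.castSucc → branch r i ∈ S} =
      ∑ k : Fin (b + 1), μ {k} * law b μ S ^ (b - k : ℕ) := by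
  set T : Set (Fin (b + 1) × (Fin b → Config b)) := {p | ∀ i, p.1 ≤ i.castSucc → p.2 i ∈ S}
  have hsection : ∀ k, Prod.mk k ⁻¹' T =
      Set.univ.pi fun i => if k ≤ i.castSucc then S else Set.univ := fun k => by
    ext x
    simp only [T, Set.mem_preimage, Set.mem_ofPred_eq, Set.mem_univ_pi]
    exact forall_congr' fun i => by split_ifs with hi <;> simp [hi]
  have hT : MeasurableSet T := by
    have hmem : Measurable fun p => p ∈ T := measurable_from_prod_countable_right fun k => by
      have hk : MeasurableSet (Prod.mk k ⁻¹' T) := by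
        rw [hsection]
        exact .univ_pi fun i => by split_ifs <;> simp [hS]
      exact measurableSet_setOfPred.1 hk
    exact measurableSet_setOfPred.2 hmem
  have hpow : ∀ k, Measure.pi (fun _ : Fin b => law b μ) (Prod.mk k ⁻¹' T) =
      law b μ S ^ (b - k : ℕ) := fun k => by
    rw [hsection, Measure.pi_pi, ← sum_live, ← Finset.prod_pow_eq_pow_sum]
    exact Finset.prod_congr rfl fun i _ => by unfold live; split_ifs <;> simp
  calc law b μ {r | ∀ i, r [] ≤ i.castSucc → branch r i ∈ S}
      = μ.prod (Measure.pi fun _ : Fin b => law b μ) T :=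
        (measurePreserving_split μ).measure_preimage hT.nullMeasurableSet
    _ = ∑ k : Fin (b + 1), μ {k} * law b μ S ^ (b - k : ℕ) := by
        simp only [Measure.prod_apply hT, lintegral_fintype, hpow, mul_comm]

theorem sum_mul_law_pow_le {n : ℕ} (hn : ∀ᵐ r ∂(law b μ), escapeCount r n = 0) :
    ∑ k : Fin (b + 1), μ.real {k} * (law b μ).real {r | escapeCount r (n + 1) = 0} ^ (b - k : ℕ) ≤
      (law b μ).real {r | escapeCount r (n + 1) = 0} := by
  have hbranches : ∀ᵐ r ∂(law b μ), ∀ i, escapeCount (branch r i) n = 0 :=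
    ae_all_iff.2 fun i => (measurePreserving_branch μ i).quasiMeasurePreserving.ae hn
  have hmeas : MeasurableSet {r : Config b | escapeCount r (n + 1) = 0} :=
    measurable_escapeCount (n + 1) (measurableSet_singleton 0)
  have hle : ∑ k : Fin (b + 1), μ {k} * law b μ {r | escapeCount r (n + 1) = 0} ^ (b - k : ℕ) ≤
      law b μ {r | escapeCount r (n + 1) = 0} := by
    rw [← law_forall_live_branch_mem μ hmeas]
    refine measure_mono_ae ?_
    filter_upwards [hbranches] with r hr hlive
    exact escapeCount_succ_eq_zero hlive hr
  have hle_real := ENNReal.toReal_mono (measure_ne_top _ _) hle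
  rw [ENNReal.toReal_sum fun k _ => by finiteness] at hle_real
  simpa only [ENNReal.toReal_mul, ENNReal.toReal_pow, measureReal_def] using hle_real

theorem ae_escapeCount_eq_zero (hmean : meanLive μ ≤ 1)
    (hne : ¬ ∀ᵐ k : Fin (b + 1) ∂μ, (k : ℕ) + 1 = b) (n : ℕ) :
    ∀ᵐ r ∂(law b μ), escapeCount r n = 0 := by
  induction n with
  | zero => simp
  | succ n ih =>
    have hmeas : MeasurableSet {r : Config b | escapeCount r (n + 1) = 0} :=
      measurable_escapeCount (n + 1) (measurableSet_singleton 0)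
    have hmean_sum : ∑ k : Fin (b + 1), μ.real {k} * ((b - k : ℕ) : ℝ) ≤ 1 := by
      refine le_trans (le_of_eq ?_) hmean
      simp only [meanLive, ← Nat.cast_sum, sum_live, integral_fintype Integrable.of_finite,
        smul_eq_mul]
    by_contra hpos
    have hlt : (law b μ).real {r | escapeCount r (n + 1) = 0} < 1 := by
      refine measureReal_le_one.lt_of_ne fun hone => hpos ((mem_ae_iff_prob_eq_one hmeas).2 ?_)
      rwa [measureReal_def, ENNReal.toReal_eq_one_iff] at hone
    refine hne (ae_iff_of_countable.2 fun k hk => ?_)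
    by_contra hkb
    have hzero : μ.real {k} = 0 :=
      eq_zero_of_sum_mul_pow_le (fun _ => measureReal_nonneg)
        (by rw [sum_measureReal_singleton]; simp) hmean_sum measureReal_nonneg hlt
        (sum_mul_law_pow_le μ ih) (by omega)
    exact hk ((measureReal_eq_zero_iff).1 hzero)

end Law

/-! ### A positive rate of escape with positive probability -/

section Law

variable (μ : Measure (Fin (b + 1))) [IsProbabilityMeasure μ]

theorem integral_comp_branch {f : Config b → ℝ} (hf : Measurable f) (i : Fin b) :
    ∫ r, f (branch r i) ∂(law b μ) = ∫ r, f r ∂(law b μ) := by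
  have hbranch := measurePreserving_branch μ i
  conv_rhs => rw [← hbranch.map_eq,
    integral_map hbranch.measurable.aemeasurable hf.aestronglyMeasurable]

theorem integral_mul_branches (g : Fin (b + 1) → ℝ) {F : (Fin b → Config b) → ℝ}
    (hF : Measurable F) :
    ∫ r, g (r []) * F (fun i => branch r i) ∂(law b μ) =
      (∫ k, g k ∂μ) * ∫ r, F (fun i => branch r i) ∂(law b μ) := by
  have hg : Measurable g := Measurable.of_discrete
  have hroot := measurePreserving_eval_infinitePi (fun _ : List (Fin b) => μ) []
  have hmul := ((indepFun_root_branches μ).comp hg hF).integral_fun_mul_eq_mul_integral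
    (hg.comp hroot.measurable).aestronglyMeasurable
    (hF.comp (measurePreserving_branches μ).measurable).aestronglyMeasurable
  have hroot_int : ∫ r : Config b, g (r []) ∂(law b μ) = ∫ k, g k ∂μ := by
    conv_rhs => rw [← hroot.map_eq, integral_map hroot.aemeasurable hg.aestronglyMeasurable]
  exact hroot_int ▸ hmul

theorem integral_live_mul {f : Config b → ℝ} (hf : Measurable f) (i : Fin b) :
    ∫ r, (live (r []) i : ℝ) * f (branch r i) ∂(law b μ) =
      (∫ k, (live k i : ℝ) ∂μ) * ∫ r, f r ∂(law b μ) := by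
  rw [← integral_comp_branch μ hf i]
  exact integral_mul_branches μ (fun k => (live k i : ℝ)) (F := fun x => f (x i))
    (hf.comp (measurable_pi_apply i))

theorem sum_integral_live : ∑ i : Fin b, ∫ k, (live k i : ℝ) ∂μ = meanLive μ :=
  (integral_finsetSum _ fun _ _ => Integrable.of_finite).symm

theorem memLp_live_mul {f : Config b → ℝ} (hf : MemLp f ⊤ (law b μ)) (i : Fin b) :
    MemLp (fun r => (live (r []) i : ℝ) * f (branch r i)) ⊤ (law b μ) := by
  have hlive : MemLp (fun r : Config b => (live (r []) i : ℝ)) ⊤ (law b μ) :=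
    memLp_top_of_bound (measurable_live i).aestronglyMeasurable 1 <| ae_of_all _ fun r => by
      rw [Real.norm_natCast]
      exact_mod_cast live_le_one (r []) i
  exact (hf.comp_measurePreserving (measurePreserving_branch μ i)).mul' hlive

theorem memLp_flow (m : ℝ) (h : ℕ) : MemLp (flow m h) ⊤ (law b μ) := by
  induction h with
  | zero => exact memLp_const 1
  | succ h ih => exact (memLp_finsetSum _ fun i _ => memLp_live_mul μ ih i).const_mul m⁻¹

theorem memLp_sq_flow (m : ℝ) (h : ℕ) :
    MemLp (fun r : Config b => flow m h r ^ 2) ⊤ (law b μ) := by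
  simpa only [sq] using (memLp_flow μ m h).mul' (memLp_flow μ m h)

theorem memLp_energy (m : ℝ) (h : ℕ) : MemLp (energy m h) ⊤ (law b μ) := by
  induction h with
  | zero => exact memLp_const 1
  | succ h ih =>
    exact (memLp_sq_flow μ m (h + 1)).add
      ((memLp_finsetSum _ fun i _ => memLp_live_mul μ ih i).const_mul (m⁻¹ ^ 2))

theorem integral_sum_live_mul {f : Config b → ℝ} (hf : Measurable f)
    (hf' : MemLp f ⊤ (law b μ)) :
    ∫ r, ∑ i, (live (r []) i : ℝ) * f (branch r i) ∂(law b μ) =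
      meanLive μ * ∫ r, f r ∂(law b μ) := by
  rw [integral_finsetSum _ fun i _ => (memLp_live_mul μ hf' i).integrable le_top,
    ← sum_integral_live, Finset.sum_mul]
  exact Finset.sum_congr rfl fun i _ => integral_live_mul μ hf i

theorem integral_sq_live_mul {f : Config b → ℝ} (hf : Measurable f) (i : Fin b) :
    ∫ r, ((live (r []) i : ℝ) * f (branch r i)) * ((live (r []) i : ℝ) * f (branch r i))
        ∂(law b μ) = (∫ k, (live k i : ℝ) ∂μ) * ∫ r, f r ^ 2 ∂(law b μ) := by
  rw [← integral_live_mul μ (hf.pow_const 2)]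
  congr 1
  funext r
  unfold live
  split_ifs <;> simp [sq]

theorem integral_live_mul_live_mul_le {f : Config b → ℝ} (hf : Measurable f) {i j : Fin b}
    (hij : i ≠ j) :
    ∫ r, ((live (r []) i : ℝ) * f (branch r i)) * ((live (r []) j : ℝ) * f (branch r j))
        ∂(law b μ) ≤ (∫ r, f r ∂(law b μ)) ^ 2 := by
  have hprod : ∫ r, f (branch r i) * f (branch r j) ∂(law b μ) =
      (∫ r, f r ∂(law b μ)) ^ 2 := by
    have := (((iIndepFun_branch μ).indepFun hij).comp hf hf).integral_fun_mul_eq_mul_integral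
      (hf.comp (measurable_branch i)).aestronglyMeasurable
      (hf.comp (measurable_branch j)).aestronglyMeasurable
    simpa only [Function.comp_apply, integral_comp_branch μ hf, ← sq] using this
  have hlive : ∫ k, (live k i : ℝ) * live k j ∂μ ≤ 1 := by
    refine (integral_mono Integrable.of_finite (integrable_const (1 : ℝ)) fun k => ?_).trans
      (by simp)
    exact mul_le_one₀ (Nat.cast_le_one.2 (live_le_one k i)) (Nat.cast_nonneg _)
      (Nat.cast_le_one.2 (live_le_one k j))
  rw [integral_congr_ae (ae_of_all _ fun r => mul_mul_mul_comm _ _ _ _)]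
  rw [integral_mul_branches μ (fun k => (live k i : ℝ) * live k j)
    (F := fun x => f (x i) * f (x j)) (by fun_prop), hprod]
  exact mul_le_of_le_one_left (sq_nonneg _) hlive

theorem integral_sq_sum_live_mul_le {f : Config b → ℝ} (hf : Measurable f)
    (hf' : MemLp f ⊤ (law b μ)) :
    ∫ r, (∑ i, (live (r []) i : ℝ) * f (branch r i)) ^ 2 ∂(law b μ) ≤
      meanLive μ * ∫ r, f r ^ 2 ∂(law b μ) + b ^ 2 * (∫ r, f r ∂(law b μ)) ^ 2 := by
  have hint : ∀ i j, Integrable (fun r => ((live (r []) i : ℝ) * f (branch r i)) *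
      ((live (r []) j : ℝ) * f (branch r j))) (law b μ) := fun i j =>
    ((memLp_live_mul μ hf' j).mul' (memLp_live_mul μ hf' i)).integrable le_top
  have hterm : ∀ i j, ∫ r, ((live (r []) i : ℝ) * f (branch r i)) *
      ((live (r []) j : ℝ) * f (branch r j)) ∂(law b μ) ≤
      (if i = j then (∫ k, (live k i : ℝ) ∂μ) * ∫ r, f r ^ 2 ∂(law b μ) else 0) +
        (∫ r, f r ∂(law b μ)) ^ 2 := fun i j => by
    split_ifs with hij
    · subst hij
      exact (integral_sq_live_mul μ hf i).trans_le (le_add_of_nonneg_right (sq_nonneg _))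
    · exact (integral_live_mul_live_mul_le μ hf hij).trans_eq (zero_add _).symm
  simp only [sq (∑ _, _), Finset.sum_mul_sum]
  rw [integral_finsetSum _ fun i _ => integrable_finsetSum _ fun j _ => hint i j]
  simp only [integral_finsetSum _ fun j _ => hint _ j]
  refine (Finset.sum_le_sum fun i _ => Finset.sum_le_sum fun j _ => hterm i j).trans_eq ?_
  simp only [Finset.sum_add_distrib, Finset.sum_ite_eq, Finset.mem_univ, if_true,
    ← Finset.sum_mul, sum_integral_live, Finset.sum_const, Finset.card_univ, Fintype.card_fin,
    nsmul_eq_mul]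
  ring

variable {μ}

theorem integral_flow (hm : 0 < meanLive μ) (h : ℕ) :
    ∫ r : Config b, flow (meanLive μ) h r ∂(law b μ) = 1 := by
  induction h with
  | zero => simp [flow]
  | succ h ih =>
    simp only [flow]
    rw [integral_const_mul, integral_sum_live_mul μ (measurable_flow _ h) (memLp_flow μ _ h), ih,
      mul_one, inv_mul_cancel₀ hm.ne']

theorem integral_sq_flow_le (hm : 1 < meanLive μ) (h : ℕ) :
    ∫ r : Config b, flow (meanLive μ) h r ^ 2 ∂(law b μ) ≤
      1 + b ^ 2 / (meanLive μ * (meanLive μ - 1)) := by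
  have hm0 := zero_lt_one.trans hm
  have hm1 := sub_pos.2 hm
  induction h with
  | zero => simpa [flow] using by positivity
  | succ h ih =>
    have hstep := integral_sq_sum_live_mul_le μ (measurable_flow (meanLive μ) h)
      (memLp_flow μ _ h)
    rw [integral_flow hm0, one_pow, mul_one] at hstep
    simp only [flow, mul_pow]
    rw [integral_const_mul]
    generalize meanLive μ = m at *
    calc m⁻¹ ^ 2 * _ ≤ m⁻¹ ^ 2 * (m * (1 + b ^ 2 / (m * (m - 1))) + b ^ 2) := by
          gcongr
          exact hstep.trans (by gcongr)
      _ = m⁻¹ + b ^ 2 / (m * (m - 1)) := by field_simp; ring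
      _ ≤ 1 + b ^ 2 / (m * (m - 1)) := by gcongr; exact inv_le_one_of_one_le₀ hm.le

theorem exists_integral_energy_le (hm : 1 < meanLive μ) :
    ∃ K : ℝ, 0 < K ∧ ∀ h, ∫ r : Config b, energy (meanLive μ) h r ∂(law b μ) ≤ K := by
  set m := meanLive μ
  have hm1 : 0 < m - 1 := sub_pos.2 hm
  have : 0 < m := zero_lt_one.trans hm
  set V : ℝ := 1 + b ^ 2 / (m * (m - 1))
  have hV1 : 1 ≤ V := le_add_of_nonneg_right (by positivity)
  refine ⟨V * m / (m - 1), by positivity, fun h => ?_⟩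
  induction h with
  | zero =>
    simp only [energy, integral_const, probReal_univ, smul_eq_mul, mul_one]
    rw [le_div_iff₀ hm1]
    nlinarith
  | succ h ih =>
    simp only [energy]
    rw [integral_add ((memLp_sq_flow μ m (h + 1)).integrable le_top)
      (((memLp_finsetSum _ fun i _ =>
        memLp_live_mul μ (memLp_energy μ m h) i).const_mul _).integrable le_top),
      integral_const_mul, integral_sum_live_mul μ (measurable_energy m h) (memLp_energy μ m h)]
    calc _ ≤ V + m⁻¹ ^ 2 * (m * (V * m / (m - 1))) := by
          gcongr
          exact integral_sq_flow_le hm (h + 1)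
      _ = V * m / (m - 1) := by field_simp; ring

end Law

theorem inv_le_measureReal_lt_mul_sq {Ω : Type*} [MeasurableSpace Ω] {ν : Measure Ω}
    [IsProbabilityMeasure ν] {f g : Ω → ℝ} {K : ℝ} (hf : Measurable f) (hg : Measurable g)
    (hfi : Integrable f ν) (hgi : Integrable g ν) (hfg : ∀ x, f x ^ 2 ≤ g x)
    (hf1 : ∫ x, f x ∂ν = 1) (hK : 0 < K) (hgK : ∫ x, g x ∂ν ≤ K) :
    (2 * K)⁻¹ ≤ ν.real {x | g x < 2 * K * f x ^ 2} := by
  set A : Set Ω := {x | g x < 2 * K * f x ^ 2}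
  have hAm : MeasurableSet A := measurableSet_lt hg ((hf.pow_const 2).const_mul _)
  have hpoint : ∀ x, 2 * f x ≤ K⁻¹ * g x + (K * A.indicator 1 x + 1 / 2) := fun x => by
    by_cases hx : x ∈ A
    · have hamgm : 2 * f x = K⁻¹ * f x ^ 2 + K - K⁻¹ * (f x - K) ^ 2 := by field_simp; ring
      have hsq : 0 ≤ K⁻¹ * (f x - K) ^ 2 := by positivity
      have hle : K⁻¹ * f x ^ 2 ≤ K⁻¹ * g x := by gcongr; exact hfg x
      rw [Set.indicator_of_mem hx, Pi.one_apply]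
      linarith
    · have hle : 2 * f x ^ 2 ≤ K⁻¹ * g x := by
        rw [inv_mul_eq_div, le_div_iff₀ hK]
        linarith [show 2 * K * f x ^ 2 ≤ g x from not_lt.1 hx]
      rw [Set.indicator_of_notMem hx]
      linarith [sq_nonneg (2 * f x - 1)]
  have hind : Integrable (A.indicator (1 : Ω → ℝ)) ν := (integrable_const 1).indicator hAm
  have hrest : Integrable (fun x => K * A.indicator 1 x + 1 / 2) ν :=
    (hind.const_mul K).add (integrable_const _)
  have hint : 2 ≤ K⁻¹ * ∫ x, g x ∂ν + (K * ν.real A + 1 / 2) := by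
    calc (2 : ℝ) = ∫ x, 2 * f x ∂ν := by rw [integral_const_mul, hf1, mul_one]
      _ ≤ ∫ x, (K⁻¹ * g x + (K * A.indicator 1 x + 1 / 2)) ∂ν :=
          integral_mono (hfi.const_mul 2) ((hgi.const_mul K⁻¹).add hrest) hpoint
      _ = _ := by
          rw [integral_add (hgi.const_mul _) hrest,
            integral_add (hind.const_mul K) (integrable_const _), integral_const_mul,
            integral_const_mul, integral_indicator_one hAm, integral_const, probReal_univ, one_smul]
  have hgK' : K⁻¹ * ∫ x, g x ∂ν ≤ 1 := by rwa [inv_mul_le_iff₀ hK, mul_one]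
  rw [inv_le_iff_one_le_mul₀ (by positivity)]
  linarith

theorem div_le_levelCount {m c : ℝ} (hc : 0 < c) {h : ℕ} {r : Config b}
    (hr : energy m h r < c * flow m h r ^ 2) (n : ℕ) : n / c ≤ levelCount h r n := by
  have hflow : 0 < flow m h r ^ 2 :=
    pos_of_mul_pos_right ((energy_nonneg m h r).trans_lt hr) hc.le
  rw [div_le_iff₀ hc]
  refine le_of_mul_le_mul_right ?_ hflow
  calc n * flow m h r ^ 2 ≤ levelCount h r n * energy m h r := mul_sq_flow_le m h r n
    _ ≤ levelCount h r n * (c * flow m h r ^ 2) := by gcongr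
    _ = levelCount h r n * c * flow m h r ^ 2 := (mul_assoc _ _ _).symm

theorem ofReal_le_rate_of_forall_le_levelCount {a : ℝ} {r : Config b}
    (hr : ∀ h n : ℕ, a * n ≤ levelCount h r n) : ENNReal.ofReal a ≤ rate r :=
  RateGE.le_rate ⟨0, fun n => by
    obtain ⟨h, hh⟩ := exists_levelCount_eq r n
    rw [← hh, add_zero]
    exact hr h n⟩

theorem le_measure_ofReal_le_rate {ν : Measure (Config b)} [IsFiniteMeasure ν] {a : ℝ} {c : ℝ≥0∞}
    (hc : ∀ h, c ≤ ν {r | ∀ n : ℕ, a * n ≤ levelCount h r n}) :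
    c ≤ ν {r | ENNReal.ofReal a ≤ rate r} := by
  set D : ℕ → Set (Config b) := fun h => {r | ∀ n : ℕ, a * n ≤ levelCount h r n}
  have hmeas : ∀ h, MeasurableSet (D h) := fun h => by
    simp only [D, Set.ofPred_forall]
    exact MeasurableSet.iInter fun n => measurableSet_le measurable_const
      (measurable_from_nat.comp (measurable_levelCount h n))
  have hanti : Antitone D := fun h h' hh r hr n =>
    (hr n).trans (Nat.cast_le.2 (levelCount_antitone r n hh))
  have hlim := tendsto_measure_iInter_atTop (fun h => (hmeas h).nullMeasurableSet) hanti
    ⟨0, measure_ne_top ν _⟩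
  refine (ge_of_tendsto' hlim hc).trans (measure_mono fun r hr => ?_)
  exact ofReal_le_rate_of_forall_le_levelCount (Set.mem_iInter.1 hr)

theorem exists_measure_ofReal_le_rate_pos {μ : Measure (Fin (b + 1))} [IsProbabilityMeasure μ]
    (hm : 1 < meanLive μ) :
    ∃ a : ℝ, 0 < a ∧ 0 < law b μ {r | ENNReal.ofReal a ≤ rate r} := by
  obtain ⟨K, hK, hKle⟩ := exists_integral_energy_le hm
  refine ⟨(2 * K)⁻¹, by positivity, (ENNReal.ofReal_pos.2 (by positivity)).trans_le <|
    le_measure_ofReal_le_rate (c := ENNReal.ofReal (2 * K)⁻¹) fun h => ?_⟩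
  have hflow := inv_le_measureReal_lt_mul_sq (measurable_flow (meanLive μ) h)
    (measurable_energy _ h) ((memLp_flow μ _ h).integrable le_top)
    ((memLp_energy μ _ h).integrable le_top) (sq_flow_le_energy _ h)
    (integral_flow (zero_lt_one.trans hm) h) hK (hKle h)
  refine (ENNReal.ofReal_le_of_le_toReal hflow).trans (measure_mono fun r hr n => ?_)
  rw [inv_mul_eq_div]
  exact div_le_levelCount (by positivity) hr n

/-! ### The rate of escape for small rotors -/

theorem le_add_tsum_indicator (M : ℕ) (y : ℝ≥0∞) :
    y ≤ M + ∑' k : ℕ, {z : ℝ≥0∞ | ((M + k : ℕ) : ℝ≥0∞) < z}.indicator 1 y := by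
  cases y with
  | top => simp
  | coe y =>
    have hpartial : (⌈y - M⌉₊ : ℝ≥0∞) ≤
        ∑' k : ℕ, {z : ℝ≥0∞ | ((M + k : ℕ) : ℝ≥0∞) < z}.indicator 1 (y : ℝ≥0∞) := by
      refine le_trans (Eq.le ?_) (ENNReal.sum_le_tsum (Finset.range ⌈y - M⌉₊))
      rw [Finset.sum_congr rfl fun k hk => Set.indicator_of_mem (Set.mem_ofPred.2 ?_) _]
      · simp
      · have hlt : (M + k : ℝ≥0) < y :=
          lt_tsub_iff_left.1 (Nat.lt_ceil.1 (Finset.mem_range.1 hk))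
        exact_mod_cast hlt
    have hceil : y ≤ M + ⌈y - M⌉₊ := tsub_le_iff_left.1 (Nat.le_ceil (y - M))
    calc (y : ℝ≥0∞) ≤ M + (⌈y - M⌉₊ : ℝ≥0∞) := by exact_mod_cast hceil
      _ ≤ _ := by gcongr

theorem lintegral_le_add_tsum_measure_lt {Ω : Type*} [MeasurableSpace Ω] {ν : Measure Ω}
    [IsProbabilityMeasure ν] {f : Ω → ℝ≥0∞} (hf : Measurable f) (M : ℕ) :
    ∫⁻ x, f x ∂ν ≤ M + ∑' k : ℕ, ν {x | ((M + k : ℕ) : ℝ≥0∞) < f x} := by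
  have hmeas : ∀ k : ℕ, MeasurableSet {x | ((M + k : ℕ) : ℝ≥0∞) < f x} := fun k =>
    measurableSet_lt measurable_const hf
  calc ∫⁻ x, f x ∂ν
      ≤ ∫⁻ x, (M + ∑' k : ℕ, {x | ((M + k : ℕ) : ℝ≥0∞) < f x}.indicator 1 x) ∂ν :=
        lintegral_mono fun x => le_add_tsum_indicator M (f x)
    _ = M + ∑' k : ℕ, ν {x | ((M + k : ℕ) : ℝ≥0∞) < f x} := by
        rw [lintegral_add_left measurable_const, lintegral_const, measure_univ, mul_one,
          lintegral_tsum fun k => (measurable_one.indicator (hmeas k)).aemeasurable]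
        simp only [lintegral_indicator_one (hmeas _)]

section Law

variable (μ : Measure (Fin (b + 1))) [IsProbabilityMeasure μ]

theorem law_lt_inv_rate_succ_le (n : ℕ) :
    law b μ {r | ((n + 1 : ℕ) : ℝ≥0∞) < (rate r)⁻¹} ≤
      law b μ {r | (n : ℝ≥0∞) < (rate r)⁻¹} ^ b := by
  have hmeas : MeasurableSet {r : Config b | (n : ℝ≥0∞) < (rate r)⁻¹} :=
    measurableSet_lt measurable_const measurable_rate.inv
  calc law b μ {r | ((n + 1 : ℕ) : ℝ≥0∞) < (rate r)⁻¹}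
      ≤ law b μ ((fun r i => branch r i) ⁻¹' Set.univ.pi fun _ => {r | n < (rate r)⁻¹}) := by
        refine measure_mono fun r hr i _ => ?_
        have hlt := lt_of_lt_of_le hr (inv_rate_le_one_add r i)
        rw [Nat.cast_add, Nat.cast_one, add_comm] at hlt
        exact lt_of_add_lt_add_left hlt
    _ = law b μ {r | (n : ℝ≥0∞) < (rate r)⁻¹} ^ b := by
        rw [(measurePreserving_branches μ).measure_preimage
          (MeasurableSet.univ_pi fun _ => hmeas).nullMeasurableSet, Measure.pi_pi,
          Finset.prod_const, Finset.card_univ, Fintype.card_fin]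

theorem law_add_lt_inv_rate_le (hb : 2 ≤ b) (M k : ℕ) :
    law b μ {r | ((M + k : ℕ) : ℝ≥0∞) < (rate r)⁻¹} ≤
      law b μ {r | (M : ℝ≥0∞) < (rate r)⁻¹} ^ (k + 1) := by
  induction k with
  | zero => simp
  | succ k ih =>
    have hle : law b μ {r | ((M + k : ℕ) : ℝ≥0∞) < (rate r)⁻¹} ≤
        law b μ {r | (M : ℝ≥0∞) < (rate r)⁻¹} := measure_mono fun r hr =>
      Set.mem_ofPred.2 ((Nat.cast_le.2 (Nat.le_add_right M k)).trans_lt hr)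
    calc _ ≤ law b μ {r | ((M + k : ℕ) : ℝ≥0∞) < (rate r)⁻¹} ^ b :=
          law_lt_inv_rate_succ_le μ (M + k)
      _ ≤ law b μ {r | ((M + k : ℕ) : ℝ≥0∞) < (rate r)⁻¹} ^ 2 :=
          pow_le_pow_of_le_one zero_le prob_le_one hb
      _ ≤ _ := by
          rw [sq, pow_succ]
          exact mul_le_mul' ih hle

variable {μ}

theorem exists_law_lt_inv_rate_lt_one (hm : 1 < meanLive μ) :
    ∃ M : ℕ, law b μ {r | (M : ℝ≥0∞) < (rate r)⁻¹} < 1 := by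
  obtain ⟨a, ha, hpos⟩ := exists_measure_ofReal_le_rate_pos hm
  obtain ⟨M, hM⟩ := exists_nat_ge a⁻¹
  have hmeas : MeasurableSet {r : Config b | (M : ℝ≥0∞) < (rate r)⁻¹} :=
    measurableSet_lt measurable_const measurable_rate.inv
  refine ⟨M, prob_le_one.lt_of_ne fun hone => hpos.ne' ?_⟩
  refine measure_mono_null (fun r hr => ?_) ((prob_compl_eq_zero_iff hmeas).2 hone)
  have hinv : (rate r)⁻¹ ≤ (ENNReal.ofReal a)⁻¹ := ENNReal.inv_le_inv.2 hr
  rw [← ENNReal.ofReal_inv_of_pos ha] at hinv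
  exact not_lt.2 (hinv.trans (ENNReal.ofReal_le_of_le_toReal (by simpa using hM)))

theorem lintegral_inv_rate_ne_top (hb : 2 ≤ b) (hm : 1 < meanLive μ) :
    ∫⁻ r : Config b, (rate r)⁻¹ ∂(law b μ) ≠ ⊤ := by
  obtain ⟨M, hM⟩ := exists_law_lt_inv_rate_lt_one hm
  set p := law b μ {r | (M : ℝ≥0∞) < (rate r)⁻¹}
  have hgeom : ∫⁻ r : Config b, (rate r)⁻¹ ∂(law b μ) ≤ M + ∑' k : ℕ, p ^ (k + 1) :=
    (lintegral_le_add_tsum_measure_lt measurable_rate.inv M).trans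
      (by gcongr with k; exact law_add_lt_inv_rate_le μ hb M k)
  refine ne_top_of_le_ne_top (ENNReal.add_ne_top.2 ⟨ENNReal.natCast_ne_top M, ?_⟩) hgeom
  simp only [pow_succ, ENNReal.tsum_mul_right, ENNReal.tsum_geometric]
  exact ENNReal.mul_ne_top (ENNReal.inv_ne_top.2 (tsub_pos_of_lt hM).ne') hM.ne_top

end Law

theorem lintegral_inv_rate_le [NeZero b] (μ : Measure (Fin (b + 1))) [IsProbabilityMeasure μ] :
    ∫⁻ r : Config b, (rate r)⁻¹ ∂(law b μ) ≤
      1 + (∫⁻ r : Config b, (rate r)⁻¹ ∂(law b μ)) / b := by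
  have hbranch : ∀ i : Fin b, ∫⁻ r : Config b, (rate (branch r i))⁻¹ ∂(law b μ) =
      ∫⁻ r : Config b, (rate r)⁻¹ ∂(law b μ) := fun i =>
    (measurePreserving_branch μ i).lintegral_comp measurable_rate.inv
  have hmeas : ∀ i : Fin b, Measurable fun r : Config b => (rate (branch r i))⁻¹ := fun i =>
    (measurable_rate.comp (measurable_branch i)).inv
  calc ∫⁻ r : Config b, (rate r)⁻¹ ∂(law b μ)
      ≤ ∫⁻ r : Config b, (1 + (∑ i, (rate (branch r i))⁻¹) * ((b : ℝ≥0∞) ^ 2)⁻¹) ∂(law b μ) :=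
        lintegral_mono inv_rate_le_one_add_sum
    _ = 1 + b * (∫⁻ r : Config b, (rate r)⁻¹ ∂(law b μ)) * ((b : ℝ≥0∞) ^ 2)⁻¹ := by
        rw [lintegral_add_left measurable_const, lintegral_const, measure_univ, mul_one,
          lintegral_mul_const _ (Finset.measurable_fun_sum _ fun i _ => hmeas i),
          lintegral_finsetSum _ fun i _ => hmeas i]
        simp only [hbranch, Finset.sum_const, Finset.card_univ, Fintype.card_fin, nsmul_eq_mul]
    _ = 1 + (∫⁻ r : Config b, (rate r)⁻¹ ∂(law b μ)) / b := by
        rw [← div_eq_mul_inv, sq, ENNReal.mul_div_mul_left _ _ (NeZero.ne _)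
          (ENNReal.natCast_ne_top b)]

theorem lintegral_inv_rate_le_inv (hb : 2 ≤ b) {μ : Measure (Fin (b + 1))}
    [IsProbabilityMeasure μ] (hm : 1 < meanLive μ) :
    ∫⁻ r : Config b, (rate r)⁻¹ ∂(law b μ) ≤ (ENNReal.ofReal (((b : ℝ) - 1) / b))⁻¹ := by
  have : NeZero b := ⟨by lia⟩
  have hb' : (2 : ℝ) ≤ b := by exact_mod_cast hb
  have hpos : 0 < ((b : ℝ) - 1) / b := div_pos (by linarith) (by linarith)
  have hle := lintegral_inv_rate_le μ
  have hfin := lintegral_inv_rate_ne_top hb hm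
  lift ∫⁻ r : Config b, (rate r)⁻¹ ∂(law b μ) to ℝ≥0 using hfin with I
  have hle' : (I : ℝ) ≤ 1 + I / b := by
    rw [← ENNReal.coe_natCast, ← ENNReal.coe_div (NeZero.ne _)] at hle
    exact_mod_cast hle
  rw [← ENNReal.ofReal_inv_of_pos hpos, ← ENNReal.ofReal_coe_nnreal, inv_div]
  refine ENNReal.ofReal_le_ofReal ?_
  rw [le_div_iff₀ (by linarith)]
  field_simp at hle'
  linarith

theorem ae_rate_eq (hb : 2 ≤ b) {μ : Measure (Fin (b + 1))} [IsProbabilityMeasure μ]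
    (hm : 1 < meanLive μ) :
    ∀ᵐ r ∂(law b μ), rate r = ENNReal.ofReal (((b : ℝ) - 1) / b) := by
  have hb' : (2 : ℝ) ≤ b := by exact_mod_cast hb
  have hpos : 0 < ((b : ℝ) - 1) / b := div_pos (by linarith) (by linarith)
  have hinv : (fun _ => (ENNReal.ofReal (((b : ℝ) - 1) / b))⁻¹) =ᵐ[law b μ]
      fun r : Config b => (rate r)⁻¹ := by
    refine ae_eq_of_ae_le_of_lintegral_le
      (ae_of_all _ fun r => ENNReal.inv_le_inv.2 (rate_le hb r)) ?_
      measurable_rate.inv.aemeasurable ?_ <;>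
    rw [lintegral_const, measure_univ, mul_one]
    · exact ENNReal.inv_ne_top.2 (ENNReal.ofReal_pos.2 hpos).ne'
    · exact lintegral_inv_rate_le_inv hb hm
  filter_upwards [hinv] with r hr
  exact (inv_injective hr).symm

/-! ### The escape probability of simple random walk -/

/-- The walk which starts at `x` and makes the choices `u` is at the root at some time up to `t`. -/
def HitsBy : ℕ → Vertex b → (ℕ → Fin (b + 1)) → Prop
  | _, none, _ => True
  | 0, some _, _ => False
  | t + 1, some v, u => HitsBy t (nbr v (u 0)) fun k => u (k + 1)

/-- The distance to the root; the vertex `some []` is the child of the root. -/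
def height : Vertex b → ℕ
  | none => 0
  | some v => v.length + 1

/-- The law of a sequence of independent uniform choices of neighbours. -/
noncomputable abbrev choices (b : ℕ) : Measure (ℕ → Fin (b + 1)) :=
  Measure.infinitePi fun _ : ℕ => (PMF.uniformOfFintype (Fin (b + 1))).toMeasure

theorem measurePreserving_tail {E : Type*} [MeasurableSpace E] (μ : Measure E)
    [IsProbabilityMeasure μ] :
    MeasurePreserving (fun (u : ℕ → E) k => u (k + 1)) (Measure.infinitePi fun _ => μ)
      (Measure.infinitePi fun _ => μ) :=
  ⟨by fun_prop, Measure.map_infinitePi_infinitePi_of_inj (P := fun _ => μ) Nat.succ_injective⟩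

theorem measurePreserving_head_tail {E : Type*} [MeasurableSpace E] (μ : Measure E)
    [IsProbabilityMeasure μ] :
    MeasurePreserving (fun u : ℕ → E => (u 0, fun k => u (k + 1)))
      (Measure.infinitePi fun _ => μ) (μ.prod (Measure.infinitePi fun _ => μ)) := by
  have hhead := measurePreserving_eval_infinitePi (fun _ : ℕ => μ) 0
  have htail := measurePreserving_tail μ
  have hdisj : Disjoint (Set.range fun _ : Unit => 0) (Set.range Nat.succ) := by simp
  have hindep : IndepFun (fun u : ℕ → E => u 0) (fun u k => u (k + 1))
      (Measure.infinitePi fun _ => μ) :=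
    (indepFun_comp_of_disjoint_range (fun _ => μ) hdisj).comp (φ := fun x : Unit → E => x ())
      (measurable_pi_apply ()) measurable_id
  refine ⟨hhead.measurable.prodMk htail.measurable, ?_⟩
  rw [hindep.map_prod_eq_prod_map_map hhead.aemeasurable htail.aemeasurable, hhead.map_eq,
    htail.map_eq]

theorem measurableSet_hitsBy_nbr_of_forall {t : ℕ} (v : NonRoot b)
    (h : ∀ k, MeasurableSet {u | HitsBy t (nbr v k) u}) :
    MeasurableSet {p : Fin (b + 1) × (ℕ → Fin (b + 1)) | HitsBy t (nbr v p.1) p.2} :=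
  measurableSet_setOfPred.2 <| measurable_from_prod_countable_right fun k =>
    measurableSet_setOfPred.1 (h k)

theorem measurableSet_hitsBy (t : ℕ) (x : Vertex b) : MeasurableSet {u | HitsBy t x u} := by
  induction t generalizing x with
  | zero => cases x <;> simp [HitsBy]
  | succ t ih =>
    cases x with
    | none => simp [HitsBy]
    | some v =>
      have hsplit : Measurable fun u : ℕ → Fin (b + 1) => (u 0, fun k => u (k + 1)) := by fun_prop
      exact hsplit (measurableSet_hitsBy_nbr_of_forall v fun k => ih (nbr v k))

theorem choices_hitsBy_succ (t : ℕ) (v : NonRoot b) :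
    (choices b).real {u | HitsBy (t + 1) (some v) u} =
      (∑ k, (choices b).real {u | HitsBy t (nbr v k) u}) / (b + 1) := by
  set μ : Measure (Fin (b + 1)) := (PMF.uniformOfFintype (Fin (b + 1))).toMeasure with hμ
  set S : Set (Fin (b + 1) × (ℕ → Fin (b + 1))) := {p | HitsBy t (nbr v p.1) p.2}
  have hS : MeasurableSet S :=
    measurableSet_hitsBy_nbr_of_forall v fun k => measurableSet_hitsBy t _
  have hweight : ∀ k, μ {k} = (b + 1 : ℝ≥0∞)⁻¹ := fun k => by
    rw [hμ, PMF.toMeasure_apply_singleton _ _ (measurableSet_singleton k),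
      PMF.uniformOfFintype_apply, Fintype.card_fin, Nat.cast_add_one]
  have hsplit : choices b {u | HitsBy (t + 1) (some v) u} =
      ∑ k, choices b {u | HitsBy t (nbr v k) u} * (b + 1 : ℝ≥0∞)⁻¹ := by
    refine ((measurePreserving_head_tail μ).measure_preimage hS.nullMeasurableSet).trans ?_
    simp only [Measure.prod_apply hS, lintegral_fintype, hweight]
    rfl
  rw [measureReal_def, hsplit, ← Finset.sum_mul, ENNReal.toReal_mul,
    ENNReal.toReal_sum fun k _ => measure_ne_top _ _, div_eq_mul_inv, ENNReal.toReal_inv]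
  norm_cast

theorem sum_pow_height_nbr (β : ℝ) (v : NonRoot b) :
    ∑ k, β ^ height (nbr v k) = β ^ v.length * (1 + b * β ^ 2) := by
  have hparent : height (parent v) = v.length := by cases v <;> rfl
  have hchild : ∀ i : Fin b, height (nbr v i.succ) = v.length + 2 := fun i => rfl
  rw [Fin.sum_univ_succ, show nbr v 0 = parent v from rfl, hparent]
  simp only [hchild, Finset.sum_const, Finset.card_univ, Fintype.card_fin, nsmul_eq_mul]
  ring

theorem choices_hitsBy_le [NeZero b] (t : ℕ) (x : Vertex b) :
    (choices b).real {u | HitsBy t x u} ≤ (b : ℝ)⁻¹ ^ height x := by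
  have hb : (b : ℝ) ≠ 0 := NeZero.ne _
  induction t generalizing x with
  | zero => cases x <;> simp [HitsBy, height]
  | succ t ih =>
    cases x with
    | none => simp [HitsBy, height]
    | some v =>
      calc (choices b).real {u | HitsBy (t + 1) (some v) u}
          ≤ (∑ k, (b : ℝ)⁻¹ ^ height (nbr v k)) / (b + 1) := by
            rw [choices_hitsBy_succ]
            gcongr with k
            exact ih (nbr v k)
        _ = (b : ℝ)⁻¹ ^ height (some v) := by
            rw [sum_pow_height_nbr, height, pow_succ _ v.length]
            field_simp

-- The functions `β ^ height` are eigenfunctions of the walk away from the root: the eigenvalue is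
-- `1` for `β = 1 / b`, and takes its minimum, which is smaller than `1`, for `β = 1 / √b`.
theorem le_choices_hitsBy [NeZero b] (t : ℕ) (x : Vertex b) :
    (b : ℝ)⁻¹ ^ height x - (2 * √b / (b + 1)) ^ t * (√b)⁻¹ ^ height x ≤
      (choices b).real {u | HitsBy t x u} := by
  have hb : (1 : ℝ) ≤ b := Nat.one_le_cast.2 NeZero.one_le
  have hsqrt : 1 ≤ √(b : ℝ) := Real.one_le_sqrt.2 hb
  have hsq : √(b : ℝ) ^ 2 = b := Real.sq_sqrt (by linarith)
  induction t generalizing x with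
  | zero =>
    cases x with
    | none => simp [HitsBy, height]
    | some v =>
      have hle : (b : ℝ)⁻¹ ≤ (√b)⁻¹ := by gcongr; nlinarith
      rw [pow_zero, one_mul]
      exact (sub_nonpos.2 (by gcongr)).trans measureReal_nonneg
  | succ t ih =>
    cases x with
    | none => simpa [HitsBy, height] using by positivity
    | some v =>
      calc _ = (∑ k, ((b : ℝ)⁻¹ ^ height (nbr v k) -
              (2 * √b / (b + 1)) ^ t * (√b)⁻¹ ^ height (nbr v k))) / (b + 1) := by
            rw [Finset.sum_sub_distrib, ← Finset.mul_sum, sum_pow_height_nbr, sum_pow_height_nbr,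
              height, pow_succ _ t, pow_succ _ v.length, pow_succ _ v.length]
            generalize √(b : ℝ) = s at *
            rw [← hsq]
            field_simp
            ring
        _ ≤ (choices b).real {u | HitsBy (t + 1) (some v) u} := by
            rw [choices_hitsBy_succ]
            gcongr with k
            exact ih (nbr v k)

theorem tendsto_choices_hitsBy (hb : 2 ≤ b) (x : Vertex b) :
    Tendsto (fun t => (choices b).real {u | HitsBy t x u}) atTop (𝓝 ((b : ℝ)⁻¹ ^ height x)) := by
  have : NeZero b := ⟨by lia⟩
  have hb' : (2 : ℝ) ≤ b := by exact_mod_cast hb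
  have hsq : √(b : ℝ) ^ 2 = b := Real.sq_sqrt (by linarith)
  have hsqrt : 1 < √(b : ℝ) := (Real.lt_sqrt zero_le_one).2 (by linarith)
  have hlt : 2 * √(b : ℝ) / (b + 1) < 1 := by
    rw [div_lt_one (by linarith)]
    nlinarith
  have hlower := ((tendsto_pow_atTop_nhds_zero_of_lt_one (by positivity) hlt).mul_const
    ((√b)⁻¹ ^ height x)).const_sub ((b : ℝ)⁻¹ ^ height x)
  rw [zero_mul, sub_zero] at hlower
  exact tendsto_of_tendsto_of_tendsto_of_le_of_le hlower tendsto_const_nhds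
    (fun t => le_choices_hitsBy t x) fun t => choices_hitsBy_le t x

theorem hitsBy_srw_iff (u : ℕ → Fin (b + 1)) (t s : ℕ) :
    HitsBy t (srw u s) (fun k => u (k + s)) ↔ ∃ j ≤ t, srw u (j + s) = none := by
  simp only [← Nat.lt_succ_iff]
  induction t generalizing s with
  | zero => cases h : srw u s <;> simp [HitsBy, h]
  | succ t ih =>
    rw [Nat.exists_lt_succ_left]
    cases h : srw u s with
    | none => simp [HitsBy, h]
    | some v =>
      have hnext : srw u (s + 1) = nbr v (u s) := by simp [srw, h]
      have hshift := ih (s + 1)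
      rw [hnext] at hshift
      simpa [HitsBy, h, add_assoc, add_comm, add_left_comm] using hshift

theorem measurableSet_exists_srw_eq_none (t : ℕ) :
    MeasurableSet {u : ℕ → Fin (b + 1) | ∃ j ≤ t, srw u (j + 1) = none} := by
  simp only [← hitsBy_srw_iff]
  exact (by fun_prop : Measurable fun (u : ℕ → Fin (b + 1)) k => u (k + 1))
    (measurableSet_hitsBy t (some []))

theorem choices_exists_srw_eq_none (t : ℕ) :
    (choices b).real {u | ∃ j ≤ t, srw u (j + 1) = none} =
      (choices b).real {u | HitsBy t (some []) u} := by
  simp only [← hitsBy_srw_iff]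
  exact congrArg ENNReal.toReal ((measurePreserving_tail _).measure_preimage
    (measurableSet_hitsBy t (some [])).nullMeasurableSet)

theorem escapeProb_eq (hb : 2 ≤ b) : escapeProb b = ((b : ℝ) - 1) / b := by
  set N : ℕ → Set (ℕ → Fin (b + 1)) := fun t => {u | ∃ j ≤ t, srw u (j + 1) = none}
  have hmono : Monotone N := fun _ _ htt' _ ⟨j, hj, hu⟩ => ⟨j, hj.trans htt', hu⟩
  have hcompl : {u : ℕ → Fin (b + 1) | ∀ t, 1 ≤ t → srw u t ≠ none} = (⋃ t, N t)ᶜ := by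
    ext u
    simp only [Set.mem_ofPred_eq, Set.mem_compl_iff, Set.mem_iUnion, N]
    refine ⟨fun h ⟨_, j, _, hj⟩ => h (j + 1) (Nat.le_add_left 1 j) hj, fun h t ht ht0 => h ?_⟩
    exact ⟨t - 1, t - 1, le_rfl, by rwa [Nat.sub_add_cancel ht]⟩
  have hlim : Tendsto (fun t => (choices b).real (N t)) atTop (𝓝 ((choices b).real (⋃ t, N t))) :=
    (ENNReal.tendsto_toReal (measure_ne_top _ _)).comp (tendsto_measure_iUnion_atTop hmono)
  have hreturn : (choices b).real (⋃ t, N t) = (b : ℝ)⁻¹ :=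
    tendsto_nhds_unique hlim <| by
      simpa only [N, choices_exists_srw_eq_none, height, List.length_nil, zero_add, pow_one]
        using tendsto_choices_hitsBy hb (some [])
  rw [escapeProb, hcompl, probReal_compl_eq_one_sub
    (MeasurableSet.iUnion measurableSet_exists_srw_eq_none), hreturn]
  field_simp

/-! ### Random rotors on an arbitrary probability space -/

theorem map_eq_law {Ω : Type*} [MeasurableSpace Ω] {P : Measure Ω} {R : NonRoot b → Ω → Fin (b + 1)}
    (hmeas : ∀ w, Measurable (R w)) (hindep : iIndepFun R P)
    (hident : ∀ w w', IdentDistrib (R w) (R w') P P) (v : NonRoot b) :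
    P.map (fun ω w => R w ω) = law b (P.map (R v)) := by
  have := hindep.isProbabilityMeasure
  rw [hindep.map_fun_eq_infinitePi_map hmeas]
  simp only [fun w => (hident w v).map_eq]

theorem meanLive_map_eq {Ω : Type*} [MeasurableSpace Ω] {P : Measure Ω} [IsProbabilityMeasure P]
    {X : Ω → Fin (b + 1)} (hX : Measurable X) :
    meanLive (P.map X) = b - ∫ ω, ((X ω : ℕ) : ℝ) ∂P := by
  have := Measure.isProbabilityMeasure_map (μ := P) hX.aemeasurable
  rw [meanLive_eq, integral_map hX.aemeasurable Measurable.of_discrete.aestronglyMeasurable]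

end RotorTree

theorem theorem6_general (b : ℕ) (hb : 2 ≤ b)
    {Ω : Type*} [MeasurableSpace Ω] (P : Measure Ω) [IsProbabilityMeasure P]
    (R : RotorTree.NonRoot b → Ω → Fin (b + 1))
    (hmeas : ∀ w, Measurable (R w))
    (hindep : iIndepFun R P)
    (hident : ∀ w w', IdentDistrib (R w) (R w') P P)
    (v : RotorTree.NonRoot b)
    (hne : ¬ ∀ᵐ ω ∂P, (R v ω : ℕ) + 1 = b) :
    RotorTree.escapeProb b = ((b : ℝ) - 1) / b ∧
    (∫ ω, ((R v ω : ℕ) : ℝ) ∂P < (b : ℝ) - 1 →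
      ∀ᵐ ω ∂P, Tendsto
        (fun n : ℕ => (RotorTree.escapeCount (fun w => R w ω) n : ℝ) / (n : ℝ))
        atTop (𝓝 (RotorTree.escapeProb b))) ∧
    ((b : ℝ) - 1 ≤ ∫ ω, ((R v ω : ℕ) : ℝ) ∂P →
      ∀ᵐ ω ∂P, ∀ n : ℕ, RotorTree.escapeCount (fun w => R w ω) n = 0) := by
  have hμ := Measure.isProbabilityMeasure_map (μ := P) (hmeas v).aemeasurable
  have hR : Measurable fun ω w => R w ω := measurable_pi_lambda _ hmeas
  have hlaw := RotorTree.map_eq_law hmeas hindep hident v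
  have hmean := RotorTree.meanLive_map_eq (P := P) (hmeas v)
  rw [RotorTree.escapeProb_eq hb]
  refine ⟨rfl, fun hlt => ?_, fun hge => ?_⟩
  · have hrate := RotorTree.ae_rate_eq hb (μ := P.map (R v)) (by linarith)
    filter_upwards [ae_of_ae_map hR.aemeasurable (hlaw ▸ hrate)] with ω hω
    exact RotorTree.tendsto_of_le_rate hb _ hω.ge
  · have hzero := ae_all_iff.2 <| RotorTree.ae_escapeCount_eq_zero (P.map (R v)) (by linarith)
      fun h => hne (ae_of_ae_map (hmeas v).aemeasurable h)
    exact ae_of_ae_map hR.aemeasurable (hlaw ▸ hzero)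

theorem theorem6 (b : ℕ) (hb : 2 ≤ b)
    {Ω : Type*} [MeasurableSpace Ω] (P : Measure Ω) [IsProbabilityMeasure P]
    (R : RotorTree.NonRoot b → Ω → Fin (b + 1))
    (hmeas : ∀ w, Measurable (R w))
    (hindep : iIndepFun R P)
    (hident : ∀ w w', IdentDistrib (R w) (R w') P P)
    (v : RotorTree.NonRoot b)
    (hnondet : ¬ ∃ k : Fin (b + 1), ∀ᵐ ω ∂P, R v ω = k) :
    RotorTree.escapeProb b = ((b : ℝ) - 1) / b ∧
    (∫ ω, ((R v ω : ℕ) : ℝ) ∂P < (b : ℝ) - 1 →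
      ∀ᵐ ω ∂P, Tendsto
        (fun n : ℕ => (RotorTree.escapeCount (fun w => R w ω) n : ℝ) / (n : ℝ))
        atTop (𝓝 (RotorTree.escapeProb b))) ∧
    ((b : ℝ) - 1 ≤ ∫ ω, ((R v ω : ℕ) : ℝ) ∂P →
      ∀ᵐ ω ∂P, ∀ n : ℕ, RotorTree.escapeCount (fun w => R w ω) n = 0) :=
  theorem6_general b hb P R hmeas hindep hident v fun h =>
    hnondet ⟨⟨b - 1, by lia⟩, h.mono fun _ hω => Fin.ext (Nat.eq_sub_of_add_eq hω)⟩
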